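/- Let $\lambda>0$ and $c=\pi/\sqrt2$. For $L>0$ and impurity positions $y_1,\dots,y_{n-1}\in\Lambda_L=[-L/2,L/2]$, let $-L/2=x_0\le x_1\le\dots\le x_{n-1}\le x_n=L/2$, where $x_1,\dots,x_{n-1}$ is the increasing rearrangement of the $y_k$, let $I_j=(x_{j-1},x_j)$, and let the finite-volume Luttinger–Sy Hamiltonian be the operator $h=\bigoplus_{j=1}^{n}h_D(I_j)$ in $\bigoplus_{j=1}^n L^2(I_j)$, where $h_D(I_j)f=-\tfrac12 f''$ on the domain $\{f\in W^{2}_2(I_j): f(x_{j-1})=f(x_j)=0\}$. Its integrated density of states is $$\mathcal N_L(E)=\frac1L\,\#\{\text{eigenvalues of } h \text{ strictly below } E,\ \text{counted with multiplicity}\}.$$ Let the impurity positions be random variables on a probability space $(\Omega,\mathcal F,\mathbb P)$, and write $\mathcal N_L^\omega(E)$ for the resulting random variable. Put $$\mathcal N_\lambda(E)=\lambda\,\frac{e^{-c\lambda/\sqrt E}}{1-e^{-c\lambda/\sqrt E}},\qquad E>0.$$ 1. For every $n\ge1$ let $L_n>0$ and let $n-1$ impurities be independent and uniformly distributed over $\Lambda_{L_n}$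 (the joint law for different $n$ is arbitrary). If $n/L_n\to\lambda$ as $n\to\infty$, then almost surely $\mathcal N_{L_n}^\omega(E)\to\mathcal N_\lambda(E)$ for all $E>0$. 2. For every $n\ge1$ let $u^{(n)}_1,\dots,u^{(n)}_{n-1}$ be independent and uniformly distributed over $[-\frac12,\frac12]$ (the joint law for different $n$ is arbitrary), let $n(L)\ge1$ be integers with $n(L)/L\to\lambda$ as $L\to\infty$, and let the impurities in $\Lambda_L$ be $L\,u^{(n(L))}_k$, $1\le k<n(L)$. Then almost surely $\mathcal N_L^\omega(E)\to\mathcal N_\lambda(E)$ as $L\to\infty$, $L$ real, for all $E>0$. 3. The limit has a Lifshitz tail: as $E\downarrow0$, $$\mathcal N_\lambda(E)=\lambda e^{-c\lambda/\sqrt E}\,\bigl\{1+O(e^{-c\lambda/\sqrt E})\bigr\}\qquad\text{and}\qquad \ln\mathcal N_\lambda(E)\sim-\frac{c\lambda}{\sqrt E}.$$ -/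

import Mathlib

open MeasureTheory ProbabilityTheory Filter Topology Set Asymptotics

namespace LuttingerSy

open scoped ContDiff

/-! ### The Dirichlet operator `-Δ/2` on a bounded interval -/

/-- The Hilbert space `L²((a,b))`. -/
abbrev L2 (a b : ℝ) : Type := Lp ℂ 2 (volume.restrict (Ioo a b))

/-- Smooth functions with compact support contained in `(a,b)`. -/
def IsTestFunction (a b : ℝ) (φ : ℝ → ℝ) : Prop :=
  ContDiff ℝ ∞ φ ∧ HasCompactSupport φ ∧ tsupport φ ⊆ Ioo a b

/-- `g` is the weak derivative of `f` on `(a,b)`. -/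
def HasWeakDeriv {a b : ℝ} (f g : L2 a b) : Prop :=
  ∀ φ : ℝ → ℝ, IsTestFunction a b φ →
    ∫ x in Ioo a b, deriv φ x • f x = -∫ x in Ioo a b, φ x • g x

/-- `f` has a representative that is continuous on `[a,b]` and vanishes at both end points. -/
def VanishesAtEndpoints {a b : ℝ} (f : L2 a b) : Prop :=
  ∃ u : ℝ → ℂ, ContinuousOn u (Icc a b) ∧ u =ᵐ[volume.restrict (Ioo a b)] f ∧ u a = 0 ∧ u b = 0

theorem integrable_smul {a b : ℝ} {φ : ℝ → ℝ} (hc : Continuous φ) (hs : HasCompactSupport φ)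
    (f : L2 a b) : Integrable (fun x => φ x • f x) (volume.restrict (Ioo a b)) := by
  obtain ⟨C, hC⟩ := hc.bounded_above_of_compact_support hs
  have hf : Integrable f (volume.restrict (Ioo a b)) :=
    (Lp.memLp f).integrable (by norm_num)
  exact hf.bdd_smul C hc.aestronglyMeasurable (Eventually.of_forall hC)

theorem IsTestFunction.integrable {a b : ℝ} {φ : ℝ → ℝ} (h : IsTestFunction a b φ) (f : L2 a b) :
    Integrable (fun x => φ x • f x) (volume.restrict (Ioo a b)) :=
  integrable_smul h.1.continuous h.2.1 f

theorem IsTestFunction.integrable_deriv {a b : ℝ} {φ : ℝ → ℝ} (h : IsTestFunction a b φ)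
    (f : L2 a b) : Integrable (fun x => deriv φ x • f x) (volume.restrict (Ioo a b)) :=
  integrable_smul (h.1.continuous_deriv (by simp)) h.2.1.deriv f

theorem integral_smul_add {a b : ℝ} {ψ : ℝ → ℝ} {f f' : L2 a b}
    (h : Integrable (fun x => ψ x • f x) (volume.restrict (Ioo a b)))
    (h' : Integrable (fun x => ψ x • f' x) (volume.restrict (Ioo a b))) :
    ∫ x in Ioo a b, ψ x • (f + f' : L2 a b) x =
      (∫ x in Ioo a b, ψ x • f x) + ∫ x in Ioo a b, ψ x • f' x := by
  rw [← integral_add h h']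
  refine integral_congr_ae ?_
  filter_upwards [Lp.coeFn_add f f'] with x hx
  rw [hx, Pi.add_apply, smul_add]

theorem integral_smul_smul {a b : ℝ} (ψ : ℝ → ℝ) (c : ℂ) (f : L2 a b) :
    ∫ x in Ioo a b, ψ x • (c • f : L2 a b) x = c • ∫ x in Ioo a b, ψ x • f x := by
  rw [← integral_smul]
  refine integral_congr_ae ?_
  filter_upwards [Lp.coeFn_smul c f] with x hx
  rw [hx, Pi.smul_apply, smul_comm]

theorem HasWeakDeriv.add {a b : ℝ} {f g f' g' : L2 a b} (h : HasWeakDeriv f g)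
    (h' : HasWeakDeriv f' g') : HasWeakDeriv (f + f') (g + g') := by
  intro φ hφ
  rw [integral_smul_add (hφ.integrable_deriv f) (hφ.integrable_deriv f'),
    integral_smul_add (hφ.integrable g) (hφ.integrable g'), h φ hφ, h' φ hφ, neg_add]

theorem HasWeakDeriv.smul {a b : ℝ} {f g : L2 a b} (c : ℂ) (h : HasWeakDeriv f g) :
    HasWeakDeriv (c • f) (c • g) := by
  intro φ hφ
  rw [integral_smul_smul, integral_smul_smul, h φ hφ, smul_neg]

theorem HasWeakDeriv.zero {a b : ℝ} : HasWeakDeriv (0 : L2 a b) 0 := by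
  have h : ∀ ψ : ℝ → ℝ, ∫ x in Ioo a b, ψ x • (0 : L2 a b) x = 0 := by
    intro ψ
    simpa using integral_smul_smul ψ 0 (0 : L2 a b)
  intro φ _
  rw [h, h, neg_zero]

theorem HasWeakDeriv.eq_zero {a b : ℝ} {g : L2 a b} (h : HasWeakDeriv 0 g) : g = 0 := by
  have h0 : ∀ ψ : ℝ → ℝ, ∫ x in Ioo a b, ψ x • (0 : L2 a b) x = 0 := by
    intro ψ
    simpa using integral_smul_smul ψ 0 (0 : L2 a b)
  have hg : IntegrableOn g (Ioo a b) volume := (Lp.memLp g).integrable (by norm_num)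
  have key := isOpen_Ioo.ae_eq_zero_of_integral_contDiff_smul_eq_zero (μ := volume)
    (f := g) (U := Ioo a b) hg.locallyIntegrableOn (by
      intro φ h1 h2 h3
      have h4 := h φ ⟨h1, h2, h3⟩
      rw [h0, eq_comm, neg_eq_zero] at h4
      rw [← h4, setIntegral_eq_integral_of_forall_compl_eq_zero]
      intro x hx
      rw [image_eq_zero_of_notMem_tsupport (fun hx' => hx (h3 hx')), zero_smul])
  refine Lp.ext ?_
  filter_upwards [(ae_restrict_iff' measurableSet_Ioo).2 key,
    Lp.coeFn_zero ℂ 2 (volume.restrict (Ioo a b))] with x hx hx'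
  rw [hx, hx', Pi.zero_apply]

/-- The graph of the Dirichlet operator on `(a,b)`: the pairs `(f, -f''/2)` where `f` belongs to
the Sobolev space `W²₂((a,b))` and `f(a) = f(b) = 0`. -/
def dirichletGraph (a b : ℝ) : Submodule ℂ (L2 a b × L2 a b) where
  carrier := {p | ∃ f₁ f₂ : L2 a b, HasWeakDeriv p.1 f₁ ∧ HasWeakDeriv f₁ f₂ ∧
    VanishesAtEndpoints p.1 ∧ p.2 = (-(1 / 2) : ℂ) • f₂}
  zero_mem' := by
    refine ⟨0, 0, HasWeakDeriv.zero, HasWeakDeriv.zero, ⟨0, continuousOn_const, ?_, rfl, rfl⟩,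
      by simp⟩
    exact (Lp.coeFn_zero ℂ 2 _).symm
  add_mem' := by
    rintro ⟨f, g⟩ ⟨f', g'⟩ ⟨f₁, f₂, h₁, h₂, ⟨u, hu, huf, hua, hub⟩, hg⟩
      ⟨f₁', f₂', h₁', h₂', ⟨u', hu', huf', hua', hub'⟩, hg'⟩
    refine ⟨f₁ + f₁', f₂ + f₂', h₁.add h₁', h₂.add h₂', ⟨u + u', hu.add hu', ?_, ?_, ?_⟩, ?_⟩
    · exact (huf.add huf').trans (Lp.coeFn_add f f').symm
    · simp [hua, hua']
    · simp [hub, hub']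
    · simp only [Prod.mk_add_mk] at *
      rw [hg, hg', smul_add]
  smul_mem' := by
    rintro c ⟨f, g⟩ ⟨f₁, f₂, h₁, h₂, ⟨u, hu, huf, hua, hub⟩, hg⟩
    refine ⟨c • f₁, c • f₂, h₁.smul c, h₂.smul c, ⟨c • u, hu.const_smul c, ?_, ?_, ?_⟩, ?_⟩
    · exact (huf.const_smul c).trans (Lp.coeFn_smul c f).symm
    · simp [hua]
    · simp [hub]
    · simp only [Prod.smul_mk] at *
      rw [hg, smul_comm]

/-- The operator `h_D((a,b)) = -Δ/2` with Dirichlet conditions at `a` and `b`. -/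
noncomputable def dirichletOp (a b : ℝ) : L2 a b →ₗ.[ℂ] L2 a b :=
  (dirichletGraph a b).toLinearPMap

/-- Weak derivatives being unique, `dirichletOp` really has the prescribed graph. -/
theorem dirichletOp_graph (a b : ℝ) : (dirichletOp a b).graph = dirichletGraph a b := by
  refine Submodule.toLinearPMap_graph_eq _ ?_
  rintro ⟨f, g⟩ ⟨f₁, f₂, h₁, h₂, -, hg⟩ hf
  simp only at hf hg h₁
  subst hf
  have h₃ := h₁.eq_zero
  subst h₃
  rw [hg, h₂.eq_zero, smul_zero]

/-! ### Orthogonal sums and counting functions of operators -/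

/-- The orthogonal sum `⊕ⱼ T j` of finitely many operators, with domain `⊕ⱼ dom (T j)`. -/
noncomputable def directSumOp {ι : Type} [Fintype ι] {H : ι → Type}
    [∀ j, NormedAddCommGroup (H j)] [∀ j, InnerProductSpace ℂ (H j)]
    (T : ∀ j, H j →ₗ.[ℂ] H j) : PiLp 2 H →ₗ.[ℂ] PiLp 2 H where
  domain :=
    { carrier := {f | ∀ j, f j ∈ (T j).domain}
      zero_mem' := fun j => (T j).domain.zero_mem
      add_mem' := fun hf hg j => (T j).domain.add_mem (hf j) (hg j)
      smul_mem' := fun c _ hf j => (T j).domain.smul_mem c (hf j) }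
  toFun :=
    { toFun := fun f => WithLp.toLp 2 fun j => T j ⟨f.1 j, f.2 j⟩
      map_add' := by
        intro f g
        ext1 j
        exact (T j).map_add ⟨f.1 j, f.2 j⟩ ⟨g.1 j, g.2 j⟩
      map_smul' := by
        intro c f
        ext1 j
        exact (T j).map_smul c ⟨f.1 j, f.2 j⟩ }

/-- The number of eigenvalues of `T` that are strictly below `E`, counted with multiplicity: the
dimension of the space spanned by the corresponding eigenvectors. -/
noncomputable def eigenvalueCount {H : Type} [NormedAddCommGroup H] [InnerProductSpace ℂ H]
    (T : H →ₗ.[ℂ] H) (E : ℝ) : ℕ :=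
  Module.finrank ℂ (Submodule.span ℂ
    {f : H | ∃ μ : ℝ, μ < E ∧ ∃ hf : f ∈ T.domain, T ⟨f, hf⟩ = (μ : ℂ) • f})

/-! ### The finite-volume Luttinger-Sy model -/

/-- The box `Λ = [-L/2, L/2]`. -/
def box (L : ℝ) : Set ℝ := Icc (-(L / 2)) (L / 2)

/-- The end points `-L/2 = x₀ ≤ x₁ ≤ ⋯ ≤ xₘ ≤ xₘ₊₁ = L/2` of the `m + 1` intervals cut out of
`[-L/2, L/2]` by `m` impurities, where `x₁, …, xₘ` is the increasing rearrangement of the impurity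
positions `y`. -/
noncomputable def nodes (L : ℝ) {m : ℕ} (y : Fin m → ℝ) : Fin (m + 2) → ℝ :=
  Fin.cons (-(L / 2)) (Fin.snoc (y ∘ Tuple.sort y) (L / 2) : Fin (m + 1) → ℝ)

/-- The Luttinger-Sy Hamiltonian in `[-L/2, L/2]` with `m` impurities at `y`: the orthogonal sum
of the Dirichlet operators on the `m + 1` intervals between consecutive nodes. -/
noncomputable def hamiltonian (L : ℝ) {m : ℕ} (y : Fin m → ℝ) :
    PiLp 2 (fun j : Fin (m + 1) => L2 (nodes L y j.castSucc) (nodes L y j.succ)) →ₗ.[ℂ]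
      PiLp 2 (fun j : Fin (m + 1) => L2 (nodes L y j.castSucc) (nodes L y j.succ)) :=
  directSumOp fun j => dirichletOp (nodes L y j.castSucc) (nodes L y j.succ)

/-- The finite-volume integrated density of states: the number, per unit length, of eigenvalues
of the Hamiltonian strictly below `E`, counted with multiplicity. -/
noncomputable def finiteIDS (L : ℝ) {m : ℕ} (y : Fin m → ℝ) (E : ℝ) : ℝ :=
  (eigenvalueCount (hamiltonian L y) E : ℝ) / L

/-- The random points `Y 0, …, Y (m-1)` are independent and uniformly distributed over
`[-L/2, L/2]`. -/
structure IsUniformImpurities {Ω : Type*} [MeasurableSpace Ω] (P : Measure Ω) (L : ℝ) {m : ℕ}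
    (Y : Fin m → Ω → ℝ) : Prop where
  measurable : ∀ k, Measurable (Y k)
  indep : iIndepFun Y P
  uniform : ∀ k, pdf.IsUniform (Y k) (box L) P volume

/-! ### The limit -/

/-- The constant `c = π / √2`. -/
noncomputable def cLS : ℝ := Real.pi / √2

/-- `N_λ(E) = λ e^{-cλ/√E} / (1 - e^{-cλ/√E})`, for `E > 0`. -/
noncomputable def limitIDS (lam E : ℝ) : ℝ :=
  lam * (Real.exp (-(cLS * lam / √E)) / (1 - Real.exp (-(cLS * lam / √E))))

end LuttingerSy

/-!
On an interval of length `ℓ` the Dirichlet eigenvalues of `-Δ/2` are `(πk/ℓ)²/2`, and those below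
`E` belong to the integers `k ≥ 1` with `k · c/√E < ℓ`. The counting function of the Hamiltonian is
therefore `∑_{k ≥ 1} #{gaps longer than k · c/√E}`.

Up to the first gap, the number of gaps longer than `t` is the number of impurities with no other
impurity within distance `t` to their right. Moving one impurity changes this number by at most
two, so by McDiarmid's inequality and the Borel–Cantelli lemma it stays within `o(n)` of its mean,
which is asymptotic to `n e^{-λt}`. By monotonicity in `t`, convergence at rational `t` implies
convergence at all `t`, so one null set serves all energies; and it gives the continuous volume
limit, since the impurities in `Λ_L` depend on `L` only through their number and a scaling.

The gap lengths add up to `L`, and the limiting counts already account for all of it, since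
`∫₀^∞ λ e^{-λt} dt = 1`. Hence no length is lost to ever longer gaps, the tail of the sum over `k`
is negligible, and the limit is the geometric series `∑_{k ≥ 1} λ e^{-λkc/√E} = 𝒩_λ(E)`.
-/

namespace LuttingerSy

open scoped NNReal

/-! ### Concentration under bounded differences -/

section BoundedDifferences

/-- The bounded differences property of `f`, with constants `c`: changing the `i`-th argument
alone changes the value of `f` by at most `c i`. -/
def HasBoundedDifferences {ι : Type*} [DecidableEq ι] {X : ι → Type*} (f : (∀ i, X i) → ℝ)
    (c : ι → ℝ≥0) : Prop :=
  ∀ x i z, |f (Function.update x i z) - f x| ≤ c i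

theorem HasBoundedDifferences.abs_sub_le_sum {ι : Type*} [DecidableEq ι] [Fintype ι] {X : ι → Type*}
    {f : (∀ i, X i) → ℝ} {c : ι → ℝ≥0} (h : HasBoundedDifferences f c) (x y : ∀ i, X i) :
    |f x - f y| ≤ ∑ i, (c i : ℝ) := by
  suffices ∀ s : Finset ι, |f (s.piecewise x y) - f y| ≤ ∑ i ∈ s, (c i : ℝ) by
    simpa using this Finset.univ
  intro s
  induction s using Finset.induction_on with
  | empty => simp
  | insert j s hj ih =>
    rw [Finset.piecewise_insert, Finset.sum_insert hj]
    exact (abs_sub_le _ _ _).trans (add_le_add (h _ j _) ih)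

theorem hasSubgaussianMGF_prod {α β : Type*} [MeasurableSpace α] [MeasurableSpace β]
    {μ : Measure α} [SFinite μ] {ν : Measure β} [SFinite ν] {X : α × β → ℝ} {Y : β → ℝ}
    {a b : ℝ≥0} (hXm : Measurable X) (hX : ∀ y, HasSubgaussianMGF (fun x => X (x, y)) a μ)
    (hY : HasSubgaussianMGF Y b ν) :
    HasSubgaussianMGF (fun p => X p + Y p.2) (a + b) (μ.prod ν) := by
  have integral_section (t : ℝ) (y : β) :
      ∫ x, Real.exp (t * (X (x, y) + Y y)) ∂μ =
        Real.exp (t * Y y) * mgf (fun x => X (x, y)) μ t := by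
    rw [mgf, ← integral_const_mul]
    congr with x
    rw [← Real.exp_add]
    ring_nf
  have integral_section_le (t : ℝ) (y : β) :
      ∫ x, Real.exp (t * (X (x, y) + Y y)) ∂μ ≤
        Real.exp (t * Y y) * Real.exp (a * t ^ 2 / 2) := by
    rw [integral_section]
    gcongr
    exact (hX y).mgf_le t
  have hYt (t : ℝ) := (hY.integrable_exp_mul t).mul_const (Real.exp (a * t ^ 2 / 2))
  have hint (t : ℝ) : Integrable (fun p => Real.exp (t * (X p + Y p.2))) (μ.prod ν) := by
    have hmeas : AEStronglyMeasurable (fun p => Real.exp (t * (X p + Y p.2))) (μ.prod ν) :=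
      (((hXm.aemeasurable.add hY.aemeasurable.comp_snd).const_mul t).exp).aestronglyMeasurable
    refine (integrable_prod_iff' hmeas).2 ⟨Eventually.of_forall fun y => ?_, ?_⟩
    · simp_rw [mul_add, Real.exp_add]
      exact ((hX y).integrable_exp_mul t).mul_const _
    · simp only [Real.norm_eq_abs, Real.abs_exp]
      refine (hYt t).mono' hmeas.prod_swap.integral_prod_right' (Eventually.of_forall fun y => ?_)
      rw [Real.norm_of_nonneg (integral_nonneg fun x => (Real.exp_pos _).le)]
      exact integral_section_le t y
  refine ⟨hint, fun t => ?_⟩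
  calc mgf (fun p => X p + Y p.2) (μ.prod ν) t
      = ∫ y, ∫ x, Real.exp (t * (X (x, y) + Y y)) ∂μ ∂ν := integral_prod_symm _ (hint t)
    _ ≤ ∫ y, Real.exp (t * Y y) * Real.exp (a * t ^ 2 / 2) ∂ν :=
      integral_mono (hint t).integral_prod_right (hYt t) (integral_section_le t)
    _ = mgf Y ν t * Real.exp (a * t ^ 2 / 2) := integral_mul_const _ _
    _ ≤ Real.exp (b * t ^ 2 / 2) * Real.exp (a * t ^ 2 / 2) := by
      gcongr
      exact hY.mgf_le t
    _ = Real.exp ((a + b : ℝ≥0) * t ^ 2 / 2) := by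
      rw [← Real.exp_add]
      push_cast
      ring_nf

theorem integrable_of_abs_sub_le {α : Type*} [MeasurableSpace α] {μ : Measure α}
    [IsFiniteMeasure μ] {f : α → ℝ} {C : ℝ} (hf : Measurable f) (hC : ∀ x y, |f x - f y| ≤ C) :
    Integrable f μ := by
  rcases isEmpty_or_nonempty α with hα | ⟨⟨x₀⟩⟩
  · rw [μ.eq_zero_of_isEmpty]
    exact integrable_zero_measure
  · have hdiff : Integrable (fun x => f x - f x₀) μ :=
      .of_bound (hf.sub_const _).aestronglyMeasurable C (Eventually.of_forall fun x => hC x x₀)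
    simpa [Pi.add_def] using hdiff.add (integrable_const (f x₀))

theorem hasSubgaussianMGF_of_abs_sub_le {α : Type*} [MeasurableSpace α] {μ : Measure α}
    [IsProbabilityMeasure μ] {f : α → ℝ} {c : ℝ≥0} (hf : Measurable f)
    (hc : ∀ x y, |f x - f y| ≤ c) :
    HasSubgaussianMGF (fun x => f x - ∫ y, f y ∂μ) ((c / 2) ^ 2) μ := by
  obtain ⟨x₀⟩ := μ.nonempty_of_neZero
  have : Nonempty α := ⟨x₀⟩
  have hbdd : BddBelow (range f) :=
    ⟨f x₀ - c, by rintro _ ⟨x, rfl⟩; linarith [(abs_le.1 (hc x x₀)).1]⟩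
  have hmem (x : α) : f x ∈ Icc (⨅ y, f y) ((⨅ y, f y) + c) := by
    refine ⟨ciInf_le hbdd x, ?_⟩
    rw [← sub_le_iff_le_add]
    exact le_ciInf fun y => by linarith [(abs_le.1 (hc x y)).2]
  simpa using hasSubgaussianMGF_of_mem_Icc hf.aemeasurable (Eventually.of_forall hmem)

variable {n : ℕ} {X : Fin n → Type*} [∀ i, MeasurableSpace (X i)] {f : (∀ i, X i) → ℝ}
  {c : Fin n → ℝ≥0}

theorem HasBoundedDifferences.integral_cons {X : Fin (n + 1) → Type*}
    [∀ i, MeasurableSpace (X i)] {f : (∀ i, X i) → ℝ} {c : Fin (n + 1) → ℝ≥0}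
    {μ : Measure (X 0)} [IsProbabilityMeasure μ] (h : HasBoundedDifferences f c)
    (hint : ∀ y, Integrable (fun x => f (Fin.cons x y)) μ) :
    HasBoundedDifferences (fun y : ∀ i : Fin n, X i.succ => ∫ x, f (Fin.cons x y) ∂μ)
      (Fin.tail c) := by
  intro y i z
  rw [← integral_sub (hint _) (hint _)]
  have hle (x : X 0) :
      ‖f (Fin.cons x (Function.update y i z)) - f (Fin.cons x y)‖ ≤ c i.succ := by
    rw [Fin.cons_update]
    exact h _ _ _
  simpa [Fin.tail] using norm_integral_le_of_norm_le_const (μ := μ) (Eventually.of_forall hle)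

theorem measurePreserving_uncons {X : Fin (n + 1) → Type*} [∀ i, MeasurableSpace (X i)]
    (μ : ∀ i, Measure (X i)) [∀ i, SigmaFinite (μ i)] :
    MeasurePreserving (fun x => (x 0, Fin.tail x)) (Measure.pi μ)
      ((μ 0).prod (Measure.pi fun i => μ i.succ)) :=
  measurePreserving_piFinSuccAbove μ 0

theorem measurable_cons {X : Fin (n + 1) → Type*} [∀ i, MeasurableSpace (X i)] :
    Measurable fun p : X 0 × (∀ i : Fin n, X i.succ) => (Fin.cons p.1 p.2 : ∀ i, X i) :=
  measurable_pi_iff.2 <|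
    Fin.cases measurable_fst fun i => (measurable_pi_apply i).comp measurable_snd

/-- **McDiarmid's inequality**, in exponential moment form. -/
theorem HasBoundedDifferences.hasSubgaussianMGF {μ : ∀ i, Measure (X i)}
    [∀ i, IsProbabilityMeasure (μ i)] (h : HasBoundedDifferences f c) (hf : Measurable f) :
    HasSubgaussianMGF (fun x => f x - ∫ y, f y ∂(Measure.pi μ)) (∑ i, (c i / 2) ^ 2)
      (Measure.pi μ) := by
  induction n with
  | zero =>
    have hconst : f = fun _ => f finZeroElim := funext fun x => congrArg f (Subsingleton.elim _ _)
    rw [hconst]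
    simp
  | succ n ih =>
    set π := Measure.pi fun i : Fin n => μ i.succ
    set F : X 0 × (∀ i : Fin n, X i.succ) → ℝ := fun p => f (Fin.cons p.1 p.2) with hF
    set g : (∀ i : Fin n, X i.succ) → ℝ := fun y => ∫ x, F (x, y) ∂μ 0
    have mp := measurePreserving_uncons μ
    have hFm : Measurable F := hf.comp measurable_cons
    have hgm : Measurable g := hFm.stronglyMeasurable.integral_prod_left'.measurable
    have section_sub_le (y) (x x') : |F (x, y) - F (x', y)| ≤ c 0 := by
      simpa [hF, Fin.update_cons_zero] using h (Fin.cons x' y) 0 x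
    have hsec (y) : HasSubgaussianMGF (fun x => F (x, y) - g y) ((c 0 / 2) ^ 2) (μ 0) :=
      hasSubgaussianMGF_of_abs_sub_le (hFm.comp measurable_prodMk_right) (section_sub_le y)
    have hg : HasBoundedDifferences g (Fin.tail c) := h.integral_cons fun y =>
      integrable_of_abs_sub_le (hFm.comp measurable_prodMk_right) (section_sub_le y)
    have hmean : ∫ x, f x ∂(Measure.pi μ) = ∫ y, g y ∂π := by
      rw [← integral_prod_symm F (integrable_of_abs_sub_le hFm fun p q => h.abs_sub_le_sum _ _),
        ← mp.map_eq, integral_map mp.aemeasurable hFm.aestronglyMeasurable]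
      simp [hF]
    have hprod := hasSubgaussianMGF_prod (X := fun p => F p - g p.2)
      (hFm.sub (hgm.comp measurable_snd)) hsec (ih (μ := fun i => μ i.succ) hg hgm)
    rw [← mp.map_eq] at hprod
    simpa [Function.comp_def, hF, hmean, Fin.sum_univ_succ, Fin.tail] using
      hprod.of_map mp.measurable.aemeasurable

theorem measureReal_abs_ge_le_of_hasSubgaussianMGF {Ω : Type*} [MeasurableSpace Ω]
    {P : Measure Ω} [IsFiniteMeasure P] {X : Ω → ℝ} {c : ℝ≥0}
    (h : HasSubgaussianMGF X c P) {ε : ℝ} (hε : 0 ≤ ε) :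
    P.real {ω | ε ≤ |X ω|} ≤ 2 * Real.exp (-ε ^ 2 / (2 * c)) := by
  calc P.real {ω | ε ≤ |X ω|} = P.real ({ω | ε ≤ X ω} ∪ {ω | ε ≤ (-X) ω}) := by
        congr 1
        ext ω
        simp [le_abs]
    _ ≤ P.real {ω | ε ≤ X ω} + P.real {ω | ε ≤ (-X) ω} := measureReal_union_le _ _
    _ ≤ 2 * Real.exp (-ε ^ 2 / (2 * c)) := by
      linarith [h.measure_ge_le hε, h.neg.measure_ge_le hε]

theorem ae_tendsto_zero_of_forall_ae_eventually_lt {Ω : Type*} [MeasurableSpace Ω] {P : Measure Ω}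
    {X : ℕ → Ω → ℝ} (h : ∀ ε > 0, ∀ᵐ ω ∂P, ∀ᶠ m in atTop, |X m ω| < ε) :
    ∀ᵐ ω ∂P, Tendsto (fun m => X m ω) atTop (𝓝 0) := by
  have hq := ae_all_iff.2 fun q : ℕ => h (1 / (q + 1)) (by positivity)
  filter_upwards [hq] with ω hω
  refine Metric.tendsto_nhds.2 fun δ hδ => ?_
  obtain ⟨q, hqδ⟩ := exists_nat_one_div_lt hδ
  filter_upwards [hω q] with m hm
  rw [Real.dist_0_eq_abs]
  exact hm.trans hqδ

theorem ae_tendsto_div_of_hasSubgaussianMGF {Ω : Type*} [MeasurableSpace Ω] {P : Measure Ω}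
    [IsFiniteMeasure P] {X : ℕ → Ω → ℝ} {K : ℝ≥0} (hK : 0 < K)
    (h : ∀ m : ℕ, HasSubgaussianMGF (X m) (m * K) P) :
    ∀ᵐ ω ∂P, Tendsto (fun m : ℕ => X m ω / m) atTop (𝓝 0) := by
  refine ae_tendsto_zero_of_forall_ae_eventually_lt fun ε hε => ?_
  set r := Real.exp (-(ε ^ 2 / (2 * K))) with hr
  have htail (m : ℕ) : P {ω | ε * m ≤ |X m ω|} ≤ ENNReal.ofReal (2 * r ^ m) := by
    rw [← ofReal_measureReal]
    refine ENNReal.ofReal_le_ofReal <|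
      (measureReal_abs_ge_le_of_hasSubgaussianMGF (h m) (by positivity)).trans_eq ?_
    rcases eq_or_ne m 0 with rfl | hm
    · simp
    · rw [hr, ← Real.exp_nat_mul]
      push_cast
      congr 2
      field_simp
  have hr1 : r < 1 := Real.exp_lt_one_iff.2 (by rw [neg_lt_zero]; positivity)
  have hsum : ∑' m : ℕ, P {ω | ε * m ≤ |X m ω|} ≠ ⊤ :=
    ne_top_of_le_ne_top
      ((summable_geometric_of_lt_one (Real.exp_pos _).le hr1).mul_left 2).tsum_ofReal_ne_top
      (ENNReal.tsum_le_tsum htail)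
  filter_upwards [ae_eventually_notMem hsum] with ω hω
  filter_upwards [hω, eventually_gt_atTop 0] with m hm hm0
  rw [abs_div, Nat.abs_cast, div_lt_iff₀ (Nat.cast_pos.2 hm0)]
  exact not_le.1 hm

end BoundedDifferences

/-! ### Isolated points of a uniform sample -/

section Isolated

variable {ι : Type*} [Fintype ι] {b t : ℝ} {y y' : ι → ℝ} {j k : ι}

open Classical in
/-- The indices of the points of `y` that have no other point of `y`, and not the end point `b`,
within distance `t` to their right. For distinct points below `b`, these are the left end points of
the gaps longer than `t`, except for the gap that begins at the left end of the box. -/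
noncomputable def isolated (b t : ℝ) (y : ι → ℝ) : Finset ι :=
  {k | y k + t < b ∧ ∀ i ≠ k, y i ∉ Icc (y k) (y k + t)}

theorem mem_isolated : k ∈ isolated b t y ↔ y k + t < b ∧ ∀ i ≠ k, y i ∉ Icc (y k) (y k + t) := by
  simp [isolated]

theorem isolated_anti (b : ℝ) (y : ι → ℝ) : Antitone fun t => isolated b t y := by
  intro s t hst k hk
  rw [mem_isolated] at hk ⊢
  exact ⟨by linarith [hk.1], fun i hi h => hk.2 i hi ⟨h.1, h.2.trans (by linarith)⟩⟩

theorem isolated_mul {L : ℝ} (hL : 0 < L) (b t : ℝ) (y : ι → ℝ) :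
    isolated (L * b) (L * t) (fun k => L * y k) = isolated b t y := by
  ext k
  simp only [mem_isolated, mem_Icc, ← mul_add, mul_lt_mul_iff_right₀ hL, mul_le_mul_iff_right₀ hL]

theorem eq_of_mem_isolated (hj : j ∈ isolated b t y) (hk : k ∈ isolated b t y) {x : ℝ}
    (hxj : x ∈ Icc (y j) (y j + t)) (hxk : x ∈ Icc (y k) (y k + t)) : j = k := by
  by_contra hne
  rw [mem_isolated] at hj hk
  rcases le_total (y j) (y k) with hle | hle
  · exact hj.2 k (Ne.symm hne) ⟨hle, hxk.1.trans hxj.2⟩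
  · exact hk.2 j hne ⟨hle, hxj.1.trans hxk.2⟩

theorem mem_Icc_of_mem_isolated_of_notMem (h : ∀ i ≠ j, y i = y' i) (hkj : k ≠ j)
    (hk : k ∈ isolated b t y) (hk' : k ∉ isolated b t y') : y' j ∈ Icc (y k) (y k + t) := by
  rw [mem_isolated] at hk hk'
  contrapose! hk'
  rw [← h k hkj]
  refine ⟨hk.1, fun i hi => ?_⟩
  rcases eq_or_ne i j with rfl | hij
  · exact hk'
  · exact h i hij ▸ hk.2 i hi

theorem card_isolated_le_card_isolated_add_two (h : ∀ i ≠ j, y i = y' i) :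
    (isolated b t y).card ≤ (isolated b t y').card + 2 := by
  classical
  set near := (isolated b t y).filter fun k => y' j ∈ Icc (y k) (y k + t) with hnear
  have hsub : isolated b t y \ isolated b t y' ⊆ insert j near := by
    intro k hk
    rw [Finset.mem_sdiff] at hk
    rw [Finset.mem_insert, hnear, Finset.mem_filter]
    by_cases hkj : k = j
    · exact Or.inl hkj
    · exact Or.inr ⟨hk.1, mem_Icc_of_mem_isolated_of_notMem h hkj hk.1 hk.2⟩
  have hcard : near.card ≤ 1 := Finset.card_le_one.2 fun k hk k' hk' => by
    rw [hnear, Finset.mem_filter] at hk hk'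
    exact eq_of_mem_isolated hk.1 hk'.1 hk.2 hk'.2
  have := Finset.card_le_card hsub
  have := Finset.card_insert_le j near
  have := Finset.card_le_card_sdiff_add_card (s := isolated b t y) (t := isolated b t y')
  omega

theorem hasBoundedDifferences_card_isolated [DecidableEq ι] (b t : ℝ) :
    HasBoundedDifferences (fun y : ι → ℝ => ((isolated b t y).card : ℝ)) fun _ => 2 := by
  intro y i z
  have h : ∀ k ≠ i, Function.update y i z k = y k := fun k hk => Function.update_of_ne hk z y
  have hle : ((isolated b t (Function.update y i z)).card : ℝ) ≤ (isolated b t y).card + 2 := by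
    exact_mod_cast card_isolated_le_card_isolated_add_two h
  have hge : ((isolated b t y).card : ℝ) ≤ (isolated b t (Function.update y i z)).card + 2 := by
    exact_mod_cast card_isolated_le_card_isolated_add_two fun k hk => (h k hk).symm
  rw [abs_le, NNReal.coe_ofNat]
  constructor <;> linarith

theorem measurableSet_mem_isolated (b t : ℝ) (k : ι) :
    MeasurableSet {y : ι → ℝ | k ∈ isolated b t y} := by
  simp only [mem_isolated, mem_Icc, not_and, not_le]
  measurability

theorem card_isolated_eq_sum (b t : ℝ) (y : ι → ℝ) :
    ((isolated b t y).card : ℝ) =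
      ∑ k, {y : ι → ℝ | k ∈ isolated b t y}.indicator (fun _ => (1 : ℝ)) y := by
  classical
  simp [indicator_apply]

theorem measurable_card_isolated (b t : ℝ) :
    Measurable fun y : ι → ℝ => ((isolated b t y).card : ℝ) := by
  simp_rw [card_isolated_eq_sum]
  exact Finset.measurable_fun_sum _ fun k _ =>
    measurable_const.indicator (measurableSet_mem_isolated b t k)

theorem insertNth_mem_isolated_iff {n : ℕ} (k : Fin (n + 1)) (x : ℝ) (z : Fin n → ℝ) :
    k ∈ isolated b t (k.insertNth x z : Fin (n + 1) → ℝ) ↔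
      x ∈ Iio (b - t) ∧ z ∈ univ.pi fun _ => (Icc x (x + t))ᶜ := by
  rw [mem_isolated, k.forall_iff_succAbove]
  simp [lt_sub_iff_add_lt, Fin.succAbove_ne]

theorem pi_mem_isolated (μ : Measure ℝ) [IsProbabilityMeasure μ] (b t : ℝ) {n : ℕ}
    (k : Fin (n + 1)) :
    (Measure.pi fun _ : Fin (n + 1) => μ) {y | k ∈ isolated b t y} =
      ∫⁻ x in Iio (b - t), μ (Icc x (x + t))ᶜ ^ n ∂μ := by
  have mp := (measurePreserving_piFinSuccAbove (fun _ => μ) k).symm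
  have hms := measurableSet_mem_isolated b t k
  rw [← mp.measure_preimage hms.nullMeasurableSet, Measure.prod_apply (mp.measurable hms),
    ← lintegral_indicator measurableSet_Iio]
  congr with x
  have hsec : Prod.mk x ⁻¹' ((MeasurableEquiv.piFinSuccAbove (fun _ => ℝ) k).symm ⁻¹'
      {y | k ∈ isolated b t y}) =
      {z | x ∈ Iio (b - t) ∧ z ∈ univ.pi fun _ : Fin n => (Icc x (x + t))ᶜ} :=
    ext fun z => insertNth_mem_isolated_iff k x z
  rw [hsec]
  by_cases hx : x ∈ Iio (b - t)
  · simp only [hx, true_and, ofPred_mem_eq, indicator_of_mem, Measure.pi_pi, Finset.prod_const,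
      Finset.card_univ, Fintype.card_fin]
  · simp [hx]

end Isolated

section Uniform

/-- The uniform distribution on `[-1/2, 1/2]`. -/
noncomputable def unif : Measure ℝ := volume.restrict (box 1)

theorem cond_box_one : volume[|box 1] = unif := by
  norm_num [ProbabilityTheory.cond, unif, box]

instance : IsProbabilityMeasure unif :=
  cond_box_one ▸ cond_isProbabilityMeasure_of_finite (by norm_num [box]) (by norm_num [box])

instance : NullSingletonClass unif := inferInstanceAs (NullSingletonClass (volume.restrict _))

variable {t : ℝ}

theorem unif_compl_Icc {x : ℝ} (hx : -(1 / 2) ≤ x) (ht : 0 ≤ t) (hxt : x + t ≤ 1 / 2) :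
    unif (Icc x (x + t))ᶜ = ENNReal.ofReal (1 - t) := by
  have hsub : Icc x (x + t) ⊆ box 1 := Icc_subset_Icc hx hxt
  rw [prob_compl_eq_one_sub measurableSet_Icc, unif, Measure.restrict_eq_self _ hsub,
    Real.volume_Icc, add_sub_cancel_left, ENNReal.ofReal_sub _ ht, ENNReal.ofReal_one]

theorem pi_unif_mem_isolated (ht : 0 ≤ t) {n : ℕ} (k : Fin (n + 1)) :
    (Measure.pi fun _ : Fin (n + 1) => unif) {y | k ∈ isolated (1 / 2) t y} =
      ENNReal.ofReal (1 - t) ^ (n + 1) := by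
  have hinter : Iio (1 / 2 - t) ∩ box 1 = Ico (-(1 / 2)) (1 / 2 - t) := by
    ext x
    simp only [box, mem_inter_iff, mem_Iio, mem_Icc, mem_Ico]
    grind
  rw [pi_mem_isolated]
  conv_lhs => rw [unif, Measure.restrict_restrict measurableSet_Iio, ← unif, hinter]
  rw [setLIntegral_congr_fun measurableSet_Ico (g := fun _ => ENNReal.ofReal (1 - t) ^ n),
    setLIntegral_const, Real.volume_Ico, pow_succ]
  · ring_nf
  · intro x hx
    simp only [unif_compl_Icc hx.1 ht (show x + t ≤ 1 / 2 by linarith [hx.2])]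

theorem integral_card_isolated (ht : 0 ≤ t) (ht1 : t ≤ 1) (m : ℕ) :
    ∫ y, ((isolated (1 / 2) t y).card : ℝ) ∂(Measure.pi fun _ : Fin m => unif) =
      m * (1 - t) ^ m := by
  have hk (k : Fin m) :
      ∫ y, {y : Fin m → ℝ | k ∈ isolated (1 / 2) t y}.indicator (fun _ => (1 : ℝ)) y
        ∂(Measure.pi fun _ : Fin m => unif) = (1 - t) ^ m := by
    obtain ⟨n, rfl⟩ := Nat.exists_eq_add_one.2 k.pos
    rw [integral_indicator_const _ (measurableSet_mem_isolated _ t k), smul_eq_mul, mul_one,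
      measureReal_def, pi_unif_mem_isolated ht, ENNReal.toReal_pow,
      ENNReal.toReal_ofReal (by linarith)]
  simp_rw [card_isolated_eq_sum]
  rw [integral_finsetSum _ fun k _ =>
    (integrable_const _).indicator (measurableSet_mem_isolated _ t k)]
  simp only [hk, Finset.sum_const, Finset.card_univ, Fintype.card_fin, nsmul_eq_mul]

theorem tendsto_integral_card_isolated_div {s : ℝ} (hs : 0 ≤ s) :
    Tendsto (fun m : ℕ => (∫ y, ((isolated (1 / 2) (s / m) y).card : ℝ)
      ∂(Measure.pi fun _ : Fin m => unif)) / m) atTop (𝓝 (Real.exp (-s))) := by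
  refine (Real.tendsto_one_add_div_pow_exp (-s)).congr' ?_
  filter_upwards [eventually_ge_atTop ⌈s⌉₊, eventually_gt_atTop 0] with m hm hm0
  have hm0' : (0 : ℝ) < m := Nat.cast_pos.2 hm0
  rw [integral_card_isolated (by positivity) ((div_le_one hm0').2 (Nat.ceil_le.1 hm)),
    mul_div_cancel_left₀ _ hm0'.ne', neg_div, sub_eq_add_neg]

end Uniform

section Typical

variable {Ω : Type*} [MeasurableSpace Ω] {P : Measure Ω}

theorem IsUniformImpurities.map_apply_eq_unif {m : ℕ} {U : Fin m → Ω → ℝ}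
    (hU : IsUniformImpurities P 1 U) (k : Fin m) : P.map (U k) = unif :=
  Eq.trans (hU.uniform k) cond_box_one

theorem IsUniformImpurities.ae_mem_box {m : ℕ} {U : Fin m → Ω → ℝ}
    (hU : IsUniformImpurities P 1 U) : ∀ᵐ ω ∂P, ∀ k, U k ω ∈ box 1 := by
  refine ae_all_iff.2 fun k => ae_of_ae_map (hU.measurable k).aemeasurable ?_
  rw [hU.map_apply_eq_unif]
  exact ae_restrict_mem measurableSet_Icc

variable [IsProbabilityMeasure P]

theorem ae_ne_of_indepFun {X Y : Ω → ℝ} (hX : Measurable X) (hY : Measurable Y)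
    (h : IndepFun X Y P) [NullSingletonClass (P.map Y)] : ∀ᵐ ω ∂P, X ω ≠ Y ω := by
  have hdiag : MeasurableSet {p : ℝ × ℝ | p.1 ≠ p.2} :=
    (measurableSet_eq_fun measurable_fst measurable_snd).compl
  have hprod := (indepFun_iff_map_prod_eq_prod_map_map hX.aemeasurable hY.aemeasurable).1 h
  refine ae_of_ae_map (p := fun p : ℝ × ℝ => p.1 ≠ p.2) (hX.prodMk hY).aemeasurable ?_
  rw [hprod, Measure.ae_prod_iff_ae_ae hdiag]
  exact Eventually.of_forall fun x => (Measure.ae_ne _ x).mono fun y hy => hy.symm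

theorem IsUniformImpurities.ae_injective {m : ℕ} {U : Fin m → Ω → ℝ}
    (hU : IsUniformImpurities P 1 U) : ∀ᵐ ω ∂P, Function.Injective fun k => U k ω := by
  have hne (i j : Fin m) (hij : i ≠ j) : ∀ᵐ ω ∂P, U i ω ≠ U j ω := by
    have : NullSingletonClass (P.map (U j)) := by
      rw [hU.map_apply_eq_unif]
      infer_instance
    exact ae_ne_of_indepFun (hU.measurable i) (hU.measurable j) (hU.indep.indepFun hij)
  have hall : ∀ᵐ ω ∂P, ∀ i j : Fin m, i ≠ j → U i ω ≠ U j ω := by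
    simpa only [ae_all_iff] using hne
  filter_upwards [hall] with ω hω i j
  exact not_imp_not.1 (hω i j)

theorem IsUniformImpurities.map_eq_pi_unif {m : ℕ} {U : Fin m → Ω → ℝ}
    (hU : IsUniformImpurities P 1 U) : P.map (fun ω k => U k ω) = Measure.pi fun _ => unif := by
  rw [(iIndepFun_iff_map_fun_eq_pi_map fun k => (hU.measurable k).aemeasurable).1 hU.indep]
  simp_rw [hU.map_apply_eq_unif]

theorem IsUniformImpurities.hasSubgaussianMGF {m : ℕ} {U : Fin m → Ω → ℝ}
    (hU : IsUniformImpurities P 1 U) {f : (Fin m → ℝ) → ℝ} {c : Fin m → ℝ≥0} (hf : Measurable f)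
    (h : HasBoundedDifferences f c) :
    HasSubgaussianMGF (fun ω => f (fun k => U k ω) - ∫ y, f y ∂(Measure.pi fun _ => unif))
      (∑ i, (c i / 2) ^ 2) P := by
  have hpi := h.hasSubgaussianMGF (μ := fun _ => unif) hf
  rw [← hU.map_eq_pi_unif] at hpi ⊢
  exact hpi.of_map (measurable_pi_iff.2 hU.measurable).aemeasurable

theorem ae_tendsto_card_isolated_div {U : ∀ m : ℕ, Fin m → Ω → ℝ}
    (hU : ∀ m, IsUniformImpurities P 1 (U m)) {s : ℝ} (hs : 0 ≤ s) :
    ∀ᵐ ω ∂P, Tendsto (fun m : ℕ => ((isolated (1 / 2) (s / m) fun k => U m k ω).card : ℝ) / m)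
      atTop (𝓝 (Real.exp (-s))) := by
  have hsub (m : ℕ) := (hU m).hasSubgaussianMGF (measurable_card_isolated (1 / 2) (s / m))
    (hasBoundedDifferences_card_isolated (1 / 2) (s / m))
  filter_upwards [ae_tendsto_div_of_hasSubgaussianMGF one_pos (by simpa using hsub)] with ω hω
  simpa [sub_div] using hω.add (tendsto_integral_card_isolated_div hs)

/-- Samples of all sizes whose points are distinct, lie in `[-1/2, 1/2]`, and have asymptotically
exponentially distributed spacings. -/
structure IsTypical (u : ∀ m : ℕ, Fin m → ℝ) : Prop where
  injective : ∀ m, Function.Injective (u m)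
  mem_box : ∀ m k, u m k ∈ box 1
  tendsto_isolated : ∀ q : ℚ, 0 < q → Tendsto
    (fun m : ℕ => ((isolated (1 / 2) (q / m) (u m)).card : ℝ) / m) atTop (𝓝 (Real.exp (-q)))

theorem ae_isTypical {U : ∀ m : ℕ, Fin m → Ω → ℝ} (hU : ∀ m, IsUniformImpurities P 1 (U m)) :
    ∀ᵐ ω ∂P, IsTypical fun m k => U m k ω := by
  have hlim : ∀ᵐ ω ∂P, ∀ q : ℚ, 0 < q → Tendsto
      (fun m : ℕ => ((isolated (1 / 2) (q / m) fun k => U m k ω).card : ℝ) / m) atTop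
      (𝓝 (Real.exp (-q))) := by
    simp only [ae_all_iff]
    exact fun q hq => ae_tendsto_card_isolated_div hU (by exact_mod_cast hq.le)
  filter_upwards [ae_all_iff.2 fun m => (hU m).ae_injective,
    ae_all_iff.2 fun m => (hU m).ae_mem_box, hlim] with ω hinj hmem hlim
  exact ⟨hinj, hmem, hlim⟩

end Typical

/-! ### Counting multiples below the gaps -/

section Multiples

/-- The number of integers `k ≥ 1` with `k * a < l`, for `a > 0`. -/
noncomputable def multiplesBelow (a l : ℝ) : ℕ := ⌈l / a⌉₊ - 1

variable {a l : ℝ}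

theorem le_multiplesBelow_iff (ha : 0 < a) {k : ℕ} (hk : 1 ≤ k) :
    k ≤ multiplesBelow a l ↔ k * a < l := by
  rw [← lt_div_iff₀ ha, ← Nat.lt_ceil, multiplesBelow]
  omega

theorem multiplesBelow_mul_le (ha : 0 < a) (hl : 0 ≤ l) : multiplesBelow a l * a ≤ l := by
  rcases Nat.eq_zero_or_pos (multiplesBelow a l) with h | h
  · simpa [h] using hl
  · exact ((le_multiplesBelow_iff ha h).1 le_rfl).le

theorem min_multiplesBelow (ha : 0 < a) (l : ℝ) (K : ℕ) :
    min K (multiplesBelow a l) = ∑ k ∈ Finset.Icc 1 K, if k * a < l then 1 else 0 := by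
  have hfilter : (Finset.Icc 1 K).filter (fun k : ℕ => k * a < l) =
      Finset.Icc 1 (min K (multiplesBelow a l)) := by
    ext k
    simp only [Finset.mem_filter, Finset.mem_Icc, le_min_iff, and_assoc]
    exact and_congr_right fun hk => and_congr_right fun _ => (le_multiplesBelow_iff ha hk).symm
  rw [← Finset.card_filter, hfilter, Nat.card_Icc, Nat.add_sub_cancel]

/-- The multiples of `a` beyond `K * a` are controlled by the excess of `l` over `K * a`, which is
at most what the first `K ^ 2` multiples of `a / K` leave uncovered. -/
theorem multiplesBelow_le_min_add (ha : 0 < a) (hl : 0 ≤ l) {K : ℕ} (hK : 0 < K) :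
    (multiplesBelow a l : ℝ) ≤ (min K (multiplesBelow a l) : ℕ) +
      (l - a / K * (min (K ^ 2) (multiplesBelow (a / K) l) : ℕ)) / a := by
  set covered := a / K * (min (K ^ 2) (multiplesBelow (a / K) l) : ℕ) with hcovered
  have hle : covered ≤ l :=
    calc
      covered ≤ a / K * multiplesBelow (a / K) l := by
        rw [hcovered]; gcongr; exact min_le_right _ _
      _ = multiplesBelow (a / K) l * (a / K) := mul_comm _ _
      _ ≤ l := multiplesBelow_mul_le (by positivity) hl
  have hle' : covered ≤ K * a :=
    calc
      covered ≤ a / K * (K ^ 2 : ℕ) := by rw [hcovered]; gcongr; exact min_le_left _ _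
      _ = K * a := by push_cast; field_simp
  rw [← sub_le_iff_le_add', le_div_iff₀ ha, sub_mul]
  rcases le_total (multiplesBelow a l) K with h | h
  · rw [min_eq_right h, sub_self]
    exact sub_nonneg.2 hle
  · rw [min_eq_left h]
    exact sub_le_sub (multiplesBelow_mul_le ha hl) hle'

theorem tendsto_of_eventually_le_of_eventually_le {α κ : Type*} {l : Filter α} {k : Filter κ}
    [k.NeBot] {X : α → ℝ} {A B : κ → α → ℝ} {S T : κ → ℝ} {R : ℝ} (hAX : ∀ i, A i ≤ᶠ[l] X)
    (hXB : ∀ᶠ i in k, X ≤ᶠ[l] B i) (hA : ∀ i, Tendsto (A i) l (𝓝 (S i)))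
    (hB : ∀ᶠ i in k, Tendsto (B i) l (𝓝 (T i))) (hS : Tendsto S k (𝓝 R))
    (hT : Tendsto T k (𝓝 R)) : Tendsto X l (𝓝 R) := by
  refine tendsto_order.2 ⟨fun b hb => ?_, fun b hb => ?_⟩
  · obtain ⟨i, hi⟩ := (hS.eventually_const_lt hb).exists
    filter_upwards [(hA i).eventually_const_lt hi, hAX i] with x hbA hAX
    exact hbA.trans_le hAX
  · obtain ⟨i, hi, hXB, hB⟩ := ((hT.eventually_lt_const hb).and (hXB.and hB)).exists
    filter_upwards [hB.eventually_lt_const hi, hXB] with x hBb hXB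
    exact hXB.trans_lt hBb

section Gaps

variable {α : Type*} {l : Filter α} {ι : α → Type*} [∀ x, Fintype (ι x)] {gap : ∀ x, ι x → ℝ}
  {L : α → ℝ} {g : ℝ → ℝ}

theorem tendsto_sum_min_multiplesBelow
    (hcount : ∀ t : ℝ, 0 < t →
      Tendsto (fun x => (Finset.card {j | t < gap x j} : ℝ) / L x) l (𝓝 (g t)))
    (ha : 0 < a) (K : ℕ) :
    Tendsto (fun x => (∑ j, ((min K (multiplesBelow a (gap x j)) : ℕ) : ℝ)) / L x) l
      (𝓝 (∑ k ∈ Finset.Icc 1 K, g (k * a))) := by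
  have hsum : Tendsto (fun x => ∑ k ∈ Finset.Icc 1 K,
      (Finset.card {j | k * a < gap x j} : ℝ) / L x) l (𝓝 (∑ k ∈ Finset.Icc 1 K, g (k * a))) := by
    refine tendsto_finsetSum _ fun k hk => hcount (k * a) ?_
    have : (1 : ℝ) ≤ k := by exact_mod_cast (Finset.mem_Icc.1 hk).1
    positivity
  refine hsum.congr fun x => ?_
  simp only [min_multiplesBelow ha, Finset.natCast_card_filter, ← Finset.sum_div, Nat.cast_sum,
    Nat.cast_ite, Nat.cast_one, Nat.cast_zero]
  rw [Finset.sum_comm]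

/-- That the gaps add up to the length provides the uniform integrability: by `hmass`, no length is
lost in the tail of the limiting gap distribution. -/
theorem tendsto_sum_multiplesBelow (hL : ∀ᶠ x in l, 0 < L x) (hgap : ∀ᶠ x in l, ∀ j, 0 ≤ gap x j)
    (hsum : ∀ᶠ x in l, ∑ j, gap x j = L x)
    (hcount : ∀ t : ℝ, 0 < t →
      Tendsto (fun x => (Finset.card {j | t < gap x j} : ℝ) / L x) l (𝓝 (g t)))
    (ha : 0 < a) {R : ℝ}
    (hR : Tendsto (fun K : ℕ => ∑ k ∈ Finset.Icc 1 K, g (k * a)) atTop (𝓝 R))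
    (hmass : Tendsto (fun K : ℕ => a / K * ∑ k ∈ Finset.Icc 1 (K ^ 2), g (k * (a / K))) atTop
      (𝓝 1)) :
    Tendsto (fun x => (∑ j, (multiplesBelow a (gap x j) : ℝ)) / L x) l (𝓝 R) := by
  let count (b : ℝ) (K : ℕ) (x : α) : ℝ :=
    (∑ j, ((min K (multiplesBelow b (gap x j)) : ℕ) : ℝ)) / L x
  have hlim {b : ℝ} (hb : 0 < b) (K : ℕ) :
      Tendsto (count b K) l (𝓝 (∑ k ∈ Finset.Icc 1 K, g (k * b))) :=
    tendsto_sum_min_multiplesBelow hcount hb K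
  have hupper : Tendsto (fun K : ℕ => ∑ k ∈ Finset.Icc 1 K, g (k * a) +
      (1 - a / K * ∑ k ∈ Finset.Icc 1 (K ^ 2), g (k * (a / K))) / a) atTop (𝓝 R) := by
    simpa using hR.add ((hmass.const_sub 1).div_const a)
  refine tendsto_of_eventually_le_of_eventually_le (A := count a)
    (B := fun K x => count a K x + (1 - a / K * count (a / K) (K ^ 2) x) / a)
    (fun K => ?_) ?_ (hlim ha) ?_ hR hupper
  · filter_upwards [hL] with x hx
    dsimp only [count]
    gcongr
    exact min_le_right _ _
  · filter_upwards [eventually_gt_atTop 0] with K hK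
    filter_upwards [hL, hgap, hsum] with x hx hgap hsum
    have hle := Finset.sum_le_sum fun j (_ : j ∈ Finset.univ) =>
      multiplesBelow_le_min_add ha (hgap j) hK
    rw [Finset.sum_add_distrib, ← Finset.sum_div, Finset.sum_sub_distrib, ← Finset.mul_sum,
      hsum] at hle
    exact ((div_le_div_iff_of_pos_right hx).2 hle).trans_eq (by simp only [count]; field_simp)
  · filter_upwards [eventually_gt_atTop 0] with K hK
    have hK' : (0 : ℝ) < K := by exact_mod_cast hK
    exact (hlim ha K).add
      ((((hlim (div_pos ha hK') (K ^ 2)).const_mul (a / K)).const_sub 1).div_const a)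

end Gaps

section Exponential

variable {c : ℝ}

theorem sum_exp_neg_mul (hc : 0 < c) (n : ℕ) :
    ∑ k ∈ Finset.Icc 1 n, Real.exp (-(k * c)) =
      Real.exp (-c) / (1 - Real.exp (-c)) * (1 - Real.exp (-(n * c))) := by
  have hexp (k : ℕ) : Real.exp (-(k * c)) = Real.exp (-c) ^ k := by
    rw [← mul_neg, Real.exp_nat_mul]
  have hlt : Real.exp (-c) < 1 := Real.exp_lt_one_iff.2 (by linarith)
  have hne : 1 - Real.exp (-c) ≠ 0 := by linarith
  have hne' : Real.exp (-c) - 1 ≠ 0 := by linarith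
  simp only [hexp]
  rw [← Finset.Ico_add_one_right_eq_Icc, geom_sum_Ico hlt.ne (by omega)]
  field_simp
  ring

theorem tendsto_exp_neg_nat_mul (hc : 0 < c) :
    Tendsto (fun n : ℕ => Real.exp (-(n * c))) atTop (𝓝 0) :=
  Real.tendsto_exp_neg_atTop_nhds_zero.comp (tendsto_natCast_atTop_atTop.atTop_mul_const hc)

theorem tendsto_sum_exp_neg_mul (hc : 0 < c) :
    Tendsto (fun n : ℕ => ∑ k ∈ Finset.Icc 1 n, Real.exp (-(k * c))) atTop
      (𝓝 (Real.exp (-c) / (1 - Real.exp (-c)))) := by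
  simp only [sum_exp_neg_mul hc]
  simpa using ((tendsto_exp_neg_nat_mul hc).const_sub 1).const_mul
    (Real.exp (-c) / (1 - Real.exp (-c)))

theorem exp_neg_div_one_sub_exp_neg (x : ℝ) :
    Real.exp (-x) / (1 - Real.exp (-x)) = (Real.exp x - 1)⁻¹ := by
  rw [Real.exp_neg, ← mul_div_mul_left _ _ (Real.exp_ne_zero x), mul_sub,
    mul_inv_cancel₀ (Real.exp_ne_zero x), mul_one, one_div]

theorem tendsto_mul_exp_neg_div_one_sub_exp_neg :
    Tendsto (fun x : ℝ => x * (Real.exp (-x) / (1 - Real.exp (-x)))) (𝓝[≠] 0) (𝓝 1) := by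
  have hslope : Tendsto (fun x : ℝ => x⁻¹ * (Real.exp x - 1)) (𝓝[≠] 0) (𝓝 1) := by
    simpa using (Real.hasDerivAt_exp 0).tendsto_slope_zero
  simpa [exp_neg_div_one_sub_exp_neg, mul_comm] using hslope.inv₀ one_ne_zero

theorem tendsto_mul_sum_exp_neg_mul (hc : 0 < c) :
    Tendsto (fun K : ℕ => c / K * ∑ k ∈ Finset.Icc 1 (K ^ 2), Real.exp (-(k * (c / K)))) atTop
      (𝓝 1) := by
  have hne : Tendsto (fun K : ℕ => c / (K : ℝ)) atTop (𝓝[≠] 0) := by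
    refine tendsto_nhdsWithin_iff.2 ⟨tendsto_const_div_atTop_nhds_zero_nat c, ?_⟩
    filter_upwards [eventually_gt_atTop 0] with K hK
    have : (0 : ℝ) < K := by exact_mod_cast hK
    exact (div_pos hc this).ne'
  have hlim := (tendsto_mul_exp_neg_div_one_sub_exp_neg.comp hne).mul
    ((tendsto_exp_neg_nat_mul hc).const_sub 1)
  rw [sub_zero, mul_one] at hlim
  refine hlim.congr' ?_
  filter_upwards [eventually_gt_atTop 0] with K hK
  have hK' : (0 : ℝ) < K := by exact_mod_cast hK
  rw [sum_exp_neg_mul (div_pos hc hK'), Function.comp_apply, mul_assoc]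
  congr 5
  push_cast
  field_simp

end Exponential

end Multiples

/-! ### Spacings of the impurities -/

section Spacings

variable {L b t : ℝ} {m : ℕ} {y : Fin m → ℝ}

/-- The lengths of the intervals between consecutive nodes. -/
noncomputable def spacing (L : ℝ) {m : ℕ} (y : Fin m → ℝ) (j : Fin (m + 1)) : ℝ :=
  nodes L y j.succ - nodes L y j.castSucc

theorem nodes_zero (L : ℝ) (y : Fin m → ℝ) : nodes L y 0 = -(L / 2) := rfl

theorem nodes_castSucc_succ (L : ℝ) (y : Fin m → ℝ) (k : Fin m) :
    nodes L y k.succ.castSucc = y (Tuple.sort y k) := by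
  rw [nodes, ← Fin.succ_castSucc, Fin.cons_succ, Fin.snoc_castSucc, Function.comp_apply]

theorem nodes_last (L : ℝ) (y : Fin m → ℝ) : nodes L y (Fin.last (m + 1)) = L / 2 := by
  rw [nodes, ← Fin.succ_last, Fin.cons_succ, Fin.snoc_last]

theorem sum_spacing (L : ℝ) (y : Fin m → ℝ) : ∑ j, spacing L y j = L := by
  simp only [spacing, Finset.sum_sub_distrib]
  have h₁ := Fin.sum_univ_succ (nodes L y)
  have h₂ := Fin.sum_univ_castSucc (nodes L y)
  rw [nodes_zero] at h₁
  rw [nodes_last] at h₂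
  linarith

theorem nodes_mem_box (hL : 0 ≤ L) (hy : ∀ k, y k ∈ box L) (i : Fin (m + 2)) :
    nodes L y i ∈ box L := by
  cases i using Fin.lastCases with
  | last => exact nodes_last L y ▸ right_mem_Icc.2 (by linarith)
  | cast i =>
    cases i using Fin.cases with
    | zero => exact nodes_zero L y ▸ left_mem_Icc.2 (by linarith)
    | succ k => exact nodes_castSucc_succ L y k ▸ hy _

theorem nodes_monotone (hL : 0 ≤ L) (hy : ∀ k, y k ∈ box L) : Monotone (nodes L y) := by
  intro i j hij
  cases j using Fin.lastCases with
  | last => exact nodes_last L y ▸ (nodes_mem_box hL hy i).2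
  | cast j =>
    obtain ⟨i, rfl⟩ := Fin.exists_castSucc_eq.2 (hij.trans_lt j.castSucc_lt_last).ne
    rw [Fin.castSucc_le_castSucc_iff] at hij
    cases i using Fin.cases with
    | zero => exact nodes_zero L y ▸ (nodes_mem_box hL hy _).1
    | succ i =>
      obtain ⟨j, rfl⟩ := Fin.exists_succ_eq.2 ((Fin.succ_pos i).trans_le hij).ne'
      rw [nodes_castSucc_succ, nodes_castSucc_succ]
      exact Tuple.monotone_sort y (Fin.succ_le_succ_iff.1 hij)

theorem spacing_nonneg (hL : 0 ≤ L) (hy : ∀ k, y k ∈ box L) (j : Fin (m + 1)) :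
    0 ≤ spacing L y j :=
  sub_nonneg.2 (nodes_monotone hL hy j.castSucc_le_succ)

theorem mem_isolated_of_strictMono {z : Fin m → ℝ} (hz : StrictMono z) {k : Fin m} :
    k ∈ isolated b t z ↔ z k + t < b ∧ ∀ i > k, z k + t < z i := by
  rw [mem_isolated]
  refine and_congr_right fun _ => ⟨fun h i hi => ?_, fun h i hi hmem => ?_⟩
  · exact not_le.1 fun hle => h i hi.ne' ⟨hz.monotone hi.le, hle⟩
  · exact (h i (hi.lt_or_gt.resolve_left fun hik => (hz hik).not_ge hmem.1)).not_ge hmem.2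

theorem apply_mem_isolated {ι κ : Type*} [Fintype ι] [Fintype κ] (σ : κ ≃ ι) {y : ι → ℝ} {k : κ} :
    σ k ∈ isolated b t y ↔ k ∈ isolated b t (y ∘ σ) := by
  simp only [mem_isolated, ← σ.forall_congr_right (q := fun i => i ≠ σ k → _), σ.injective.ne_iff,
    Function.comp_apply]

theorem lt_spacing_succ_iff (hL : 0 ≤ L) (hy : ∀ k, y k ∈ box L) (hinj : Function.Injective y)
    (k : Fin m) : t < spacing L y k.succ ↔ Tuple.sort y k ∈ isolated (L / 2) t y := by
  have hsort : StrictMono (y ∘ Tuple.sort y) :=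
    (Tuple.monotone_sort y).strictMono_of_injective (hinj.comp (Tuple.sort y).injective)
  have hnext : t < spacing L y k.succ ↔
      ∀ i > k.succ.castSucc, y (Tuple.sort y k) + t < nodes L y i := by
    rw [spacing, nodes_castSucc_succ, lt_sub_iff_add_lt']
    refine ⟨fun h i hi => h.trans_le (nodes_monotone hL hy ?_), fun h => h _ ?_⟩
    · exact Fin.castSucc_lt_iff_succ_le.1 hi
    · exact Fin.castSucc_lt_succ
  have hzero : ¬ k.succ.castSucc < Fin.castSucc 0 := by simp
  rw [hnext, apply_mem_isolated, mem_isolated_of_strictMono hsort, Fin.forall_fin_succ',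
    Fin.forall_fin_succ]
  simp only [gt_iff_lt, hzero, Fin.castSucc_lt_castSucc_iff, Fin.succ_lt_succ_iff,
    Fin.castSucc_lt_last, nodes_castSucc_succ, nodes_last, Function.comp_apply, false_imp_iff,
    true_and, forall_const, and_comm]

theorem card_lt_spacing (hL : 0 ≤ L) (hy : ∀ k, y k ∈ box L) (hinj : Function.Injective y)
    (t : ℝ) : Finset.card {j | t < spacing L y j} =
      (if t < spacing L y 0 then 1 else 0) + (isolated (L / 2) t y).card := by
  rw [Finset.card_filter, Fin.sum_univ_succ]
  simp only [lt_spacing_succ_iff hL hy hinj]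
  rw [Equiv.sum_comp (Tuple.sort y) fun i => if i ∈ isolated (L / 2) t y then 1 else 0]
  simp

theorem mul_mem_box (hL : 0 ≤ L) {x : ℝ} (hx : x ∈ box 1) : L * x ∈ box L := by
  have := mul_le_mul_of_nonneg_left hx.1 hL
  have := mul_le_mul_of_nonneg_left hx.2 hL
  constructor <;> linarith

end Spacings

section SpacingLimit

variable {α : Type*} {l : Filter α}

theorem tendsto_apply_of_antitone {F : α → ℝ → ℝ} {G : ℝ → ℝ} {s : α → ℝ} {σ : ℝ}
    (hF : ∀ x, Antitone (F x))
    (hlim : ∀ q : ℚ, 0 < q → Tendsto (fun x => F x q) l (𝓝 (G q))) (hσ : 0 < σ)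
    (hG : ContinuousAt G σ) (hs : Tendsto s l (𝓝 σ)) :
    Tendsto (fun x => F x (s x)) l (𝓝 (G σ)) := by
  refine tendsto_order.2 ⟨fun b hb => ?_, fun b hb => ?_⟩
  · obtain ⟨u, hu, hsub⟩ := mem_nhdsGT_iff_exists_Ioo_subset.1
      ((hG.eventually_const_lt hb).filter_mono nhdsWithin_le_nhds)
    obtain ⟨q, hq⟩ := exists_rat_btwn (mem_Ioi.1 hu)
    have hq0 : (0 : ℚ) < q := by exact_mod_cast hσ.trans hq.1
    filter_upwards [(hlim q hq0).eventually_const_lt (hsub hq), hs.eventually_lt_const hq.1]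
      with x hbF hsq
    exact hbF.trans_le (hF x hsq.le)
  · obtain ⟨u, hu, hsub⟩ := mem_nhdsLT_iff_exists_Ioo_subset.1
      (((hG.eventually_lt_const hb).and (eventually_gt_nhds hσ)).filter_mono nhdsWithin_le_nhds)
    obtain ⟨q, hq⟩ := exists_rat_btwn (mem_Iio.1 hu)
    obtain ⟨hGb, hq0⟩ := hsub hq
    filter_upwards [(hlim q (by exact_mod_cast hq0)).eventually_lt_const hGb,
      hs.eventually_const_lt hq.2] with x hFb hqs
    exact (hF x hqs.le).trans_lt hFb

variable {u : ∀ m : ℕ, Fin m → ℝ} {m : α → ℕ}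

theorem IsTypical.tendsto_card_isolated_div (hu : IsTypical u) (hm : Tendsto m l atTop)
    {s : α → ℝ} {σ : ℝ} (hσ : 0 < σ) (hs : Tendsto s l (𝓝 σ)) :
    Tendsto (fun x => ((isolated (1 / 2) (s x / m x) (u (m x))).card : ℝ) / m x) l
      (𝓝 (Real.exp (-σ))) := by
  refine tendsto_apply_of_antitone (G := fun s => Real.exp (-s))
    (F := fun x s => ((isolated (1 / 2) (s / m x) (u (m x))).card : ℝ) / m x) (fun x s t hst => ?_)
    (fun q hq => (hu.tendsto_isolated q hq).comp hm) hσ (by fun_prop) hs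
  dsimp only
  gcongr
  exact isolated_anti _ _ (by gcongr)

variable {L : α → ℝ} {lam : ℝ}

theorem IsTypical.tendsto_card_lt_spacing_div (hu : IsTypical u) (hlam : 0 < lam)
    (hL : Tendsto L l atTop) (hmL : Tendsto (fun x => ((m x : ℝ) + 1) / L x) l (𝓝 lam)) {t : ℝ}
    (ht : 0 < t) :
    Tendsto (fun x => (Finset.card {j | t < spacing (L x) (fun k => L x * u (m x) k) j} : ℝ) / L x)
      l (𝓝 (lam * Real.exp (-(lam * t)))) := by
  have hL0 : ∀ᶠ x in l, 0 < L x := hL.eventually_gt_atTop 0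
  have hinv : Tendsto (fun x => 1 / L x) l (𝓝 0) := by
    simp only [one_div]
    exact hL.inv_tendsto_atTop
  have hdensity : Tendsto (fun x => (m x : ℝ) / L x) l (𝓝 lam) := by
    simpa only [← sub_div, add_sub_cancel_right, sub_zero] using hmL.sub hinv
  have hm : Tendsto m l atTop := by
    rw [← tendsto_natCast_atTop_iff (R := ℝ)]
    refine (hdensity.pos_mul_atTop hlam hL).congr' ?_
    filter_upwards [hL0] with x hx
    exact div_mul_cancel₀ _ hx.ne'
  have hfirst : Tendsto (fun x => (if t < spacing (L x) (fun k => L x * u (m x) k) 0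
      then (1 : ℝ) else 0) / L x) l (𝓝 0) := by
    refine squeeze_zero' ?_ ?_ hinv <;> filter_upwards [hL0] with x hx
    · split_ifs <;> positivity
    · gcongr
      split_ifs <;> norm_num
  have hrest := hdensity.mul
    (hu.tendsto_card_isolated_div hm (mul_pos hlam ht) (hdensity.mul_const t))
  rw [← zero_add (lam * _)]
  refine (hfirst.add hrest).congr' ?_
  filter_upwards [hL0, hm.eventually_gt_atTop 0] with x hx hmx
  have hmx' : (m x : ℝ) ≠ 0 := by exact_mod_cast hmx.ne'
  have hbox (k : Fin (m x)) : L x * u (m x) k ∈ box (L x) := mul_mem_box hx.le (hu.mem_box _ k)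
  have hscale : isolated (L x / 2) t (fun k => L x * u (m x) k) =
      isolated (1 / 2) (m x / L x * t / m x) (u (m x)) := by
    rw [← isolated_mul hx (1 / 2)]
    congr 1 <;> field_simp
  rw [card_lt_spacing hx.le hbox ((mul_right_injective₀ hx.ne').comp (hu.injective _)), hscale]
  push_cast
  field_simp

theorem IsTypical.tendsto_sum_multiplesBelow_spacing (hu : IsTypical u) (hlam : 0 < lam)
    (hL : Tendsto L l atTop) (hmL : Tendsto (fun x => ((m x : ℝ) + 1) / L x) l (𝓝 lam)) {a : ℝ}
    (ha : 0 < a) :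
    Tendsto (fun x => (∑ j, (multiplesBelow a
        (spacing (L x) (fun k => L x * u (m x) k) j) : ℝ)) / L x) l
      (𝓝 (lam * (Real.exp (-(lam * a)) / (1 - Real.exp (-(lam * a)))))) := by
  have hL0 : ∀ᶠ x in l, 0 < L x := hL.eventually_gt_atTop 0
  have hc : 0 < lam * a := mul_pos hlam ha
  refine tendsto_sum_multiplesBelow hL0 ?_ (Eventually.of_forall fun x => sum_spacing _ _)
    (fun t => hu.tendsto_card_lt_spacing_div hlam hL hmL) ha ?_ ?_
  · filter_upwards [hL0] with x hx
    exact spacing_nonneg hx.le fun k => mul_mem_box hx.le (hu.mem_box _ k)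
  · simpa only [← Finset.mul_sum, mul_left_comm] using (tendsto_sum_exp_neg_mul hc).const_mul lam
  · refine (tendsto_mul_sum_exp_neg_mul hc).congr fun K => ?_
    rw [← Finset.mul_sum, ← mul_assoc, mul_comm (a / K), mul_div_assoc]
    simp only [mul_left_comm lam]

end SpacingLimit

/-! ### Weak derivatives and regularity -/

section WeakDerivatives

variable {a b : ℝ} {φ ψ η : ℝ → ℝ}

theorem IsTestFunction.eq_zero (hφ : IsTestFunction a b φ) {x : ℝ} (hx : x ∉ Ioo a b) : φ x = 0 :=
  image_eq_zero_of_notMem_tsupport fun hx' => hx (hφ.2.2 hx')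

theorem IsTestFunction.hasDerivAt (hφ : IsTestFunction a b φ) (x : ℝ) :
    HasDerivAt φ (deriv φ x) x :=
  (hφ.1.differentiable (by simp)).differentiableAt.hasDerivAt

theorem IsTestFunction.continuous_deriv (hφ : IsTestFunction a b φ) : Continuous (deriv φ) :=
  hφ.1.continuous_deriv (by simp)

theorem IsTestFunction.integrable_self (hφ : IsTestFunction a b φ) : Integrable φ :=
  hφ.1.continuous.integrable_of_hasCompactSupport hφ.2.1

theorem IsTestFunction.setIntegral_eq (hφ : IsTestFunction a b φ) :
    ∫ x in Ioo a b, φ x = ∫ x, φ x :=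
  setIntegral_eq_integral_of_forall_compl_eq_zero fun _ => hφ.eq_zero

theorem IsTestFunction.sub_const_mul (hφ : IsTestFunction a b φ) (hψ : IsTestFunction a b ψ)
    (c : ℝ) : IsTestFunction a b fun x => φ x - c * ψ x :=
  ⟨hφ.1.sub (contDiff_const.mul hψ.1), hφ.2.1.sub hψ.2.1.mul_left,
    (tsupport_sub φ fun x => c * ψ x).trans
      (union_subset hφ.2.2 (tsupport_mul_subset_right.trans hψ.2.2))⟩

theorem IsTestFunction.exists_tsupport_subset_Icc (hη : IsTestFunction a b η) :
    ∃ α β, a < α ∧ β < b ∧ tsupport η ⊆ Icc α β := by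
  rcases (tsupport η).eq_empty_or_nonempty with hempty | hne
  · exact ⟨a + 1, b - 1, by linarith, by linarith, by simp [hempty]⟩
  · have hcompact : IsCompact (tsupport η) := hη.2.1
    obtain ⟨α, hα, hleast⟩ := hcompact.exists_isLeast hne
    obtain ⟨β, hβ, hgreatest⟩ := hcompact.exists_isGreatest hne
    exact ⟨α, β, (hη.2.2 hα).1, (hη.2.2 hβ).2, fun x hx => ⟨hleast hx, hgreatest hx⟩⟩

theorem support_primitive_subset_Icc {α β : ℝ} (hα : a < α) (hη : Function.support η ⊆ Icc α β)
    (h0 : ∫ x, η x = 0) : Function.support (fun x => ∫ y in a..x, η y) ⊆ Icc α β := by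
  intro x hx
  by_contra hxI
  refine hx ?_
  rcases lt_or_ge x α with hxα | hxα
  · refine (intervalIntegral.integral_congr (g := fun _ => 0) fun y hy => ?_).trans (by simp)
    by_contra hy0
    exact (hη hy0).1.not_gt (hy.2.trans_lt (max_lt hα hxα))
  · have hβx : β < x := not_le.1 fun h => hxI ⟨hxα, h⟩
    refine (intervalIntegral.integral_eq_integral_of_support_subset fun y hy => ?_).trans h0
    exact ⟨hα.trans_le (hη hy).1, ((hη hy).2.trans_lt hβx).le⟩

theorem IsTestFunction.exists_deriv_eq (hη : IsTestFunction a b η) (h0 : ∫ x, η x = 0) :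
    ∃ Φ, IsTestFunction a b Φ ∧ deriv Φ = η := by
  have hasDeriv (x : ℝ) : HasDerivAt (fun x => ∫ y in a..x, η y) (η x) x :=
    hη.1.continuous.integral_hasStrictDerivAt a x |>.hasDerivAt
  have hderiv : deriv (fun x => ∫ y in a..x, η y) = η := funext fun x => (hasDeriv x).deriv
  obtain ⟨α, β, hα, hβ, hsub⟩ := hη.exists_tsupport_subset_Icc
  have hsupp : tsupport (fun x => ∫ y in a..x, η y) ⊆ Icc α β :=
    closure_minimal (support_primitive_subset_Icc hα ((subset_tsupport η).trans hsub) h0)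
      isClosed_Icc
  refine ⟨_, ⟨?_, isCompact_Icc.of_isClosed_subset (isClosed_tsupport _) hsupp, ?_⟩, hderiv⟩
  · rw [contDiff_infty_iff_deriv, hderiv]
    exact ⟨fun x => (hasDeriv x).differentiableAt, hη.1⟩
  · exact hsupp.trans (Icc_subset_Ioo hα hβ)

theorem exists_isTestFunction (hab : a < b) : ∃ ψ, IsTestFunction a b ψ ∧ ∫ x, ψ x = 1 := by
  let B : ContDiffBump ((a + b) / 2) :=
    ⟨(b - a) / 8, (b - a) / 4, by linarith, by linarith⟩
  have hrOut : B.rOut = (b - a) / 4 := rfl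
  refine ⟨B.normed volume, ⟨B.contDiff_normed, B.hasCompactSupport_normed, ?_⟩, B.integral_normed⟩
  rw [B.tsupport_normed_eq, Real.closedBall_eq_Icc, hrOut]
  exact Icc_subset_Ioo (by linarith) (by linarith)

theorem memLp_of_continuous (a b : ℝ) {u : ℝ → ℂ} (hu : Continuous u) :
    MemLp u 2 (volume.restrict (Ioo a b)) := by
  obtain ⟨C, hC⟩ := (isCompact_Icc (a := a) (b := b)).exists_bound_of_continuousOn hu.continuousOn
  refine MemLp.of_bound hu.aestronglyMeasurable C ?_
  filter_upwards [ae_restrict_mem measurableSet_Ioo] with x hx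
  exact hC x (Ioo_subset_Icc_self hx)

/-- The restriction to `(a,b)` of a continuous function on the line, as an element of
`L²((a,b))`. -/
noncomputable def contLp (a b : ℝ) : C(ℝ, ℂ) →ₗ[ℂ] L2 a b where
  toFun u := (memLp_of_continuous a b u.continuous).toLp u
  map_add' _ _ := rfl
  map_smul' _ _ := rfl

theorem coeFn_contLp (a b : ℝ) (u : C(ℝ, ℂ)) : contLp a b u =ᵐ[volume.restrict (Ioo a b)] u :=
  (memLp_of_continuous a b u.continuous).coeFn_toLp

theorem contLp_congr {u w : C(ℝ, ℂ)} (h : EqOn u w (Icc a b)) : contLp a b u = contLp a b w := by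
  refine Lp.ext ?_
  filter_upwards [coeFn_contLp a b u, coeFn_contLp a b w, ae_restrict_mem measurableSet_Ioo]
    with x hu hw hx
  rw [hu, hw, h (Ioo_subset_Icc_self hx)]

theorem eqOn_Icc_of_contLp_eq (hab : a < b) {u w : C(ℝ, ℂ)} (h : contLp a b u = contLp a b w) :
    EqOn u w (Icc a b) := by
  have hae : u =ᵐ[volume.restrict (Ioo a b)] w :=
    (coeFn_contLp a b u).symm.trans (h ▸ coeFn_contLp a b w)
  exact (Measure.eqOn_open_of_ae_eq hae isOpen_Ioo u.continuous.continuousOn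
    w.continuous.continuousOn).of_subset_closure u.continuous.continuousOn
    w.continuous.continuousOn Ioo_subset_Icc_self (closure_Ioo hab.ne).symm.subset

theorem integral_smul_contLp (a b : ℝ) (φ : ℝ → ℝ) (u : C(ℝ, ℂ)) :
    ∫ x in Ioo a b, φ x • contLp a b u x = ∫ x in Ioo a b, φ x • u x :=
  integral_congr_ae ((coeFn_contLp a b u).mono fun x hx => by simp only [hx])

theorem hasWeakDeriv_contLp {u u' : C(ℝ, ℂ)} (hu : ∀ x, HasDerivAt u (u' x) x) :
    HasWeakDeriv (contLp a b u) (contLp a b u') := by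
  intro φ hφ
  rw [integral_smul_contLp, integral_smul_contLp]
  rcases le_or_gt b a with hba | hab
  · simp [Ioo_eq_empty hba.not_gt]
  have parts := intervalIntegral.integral_smul_deriv_eq_deriv_smul (a := a) (b := b)
    (fun x _ => hφ.hasDerivAt x) (fun x _ => hu x)
    (hφ.continuous_deriv.intervalIntegrable _ _) (u'.continuous.intervalIntegrable _ _)
  rw [hφ.eq_zero (x := a) (by simp), hφ.eq_zero (x := b) (by simp), zero_smul, zero_smul,
    sub_zero, zero_sub, intervalIntegral.integral_of_le hab.le,
    intervalIntegral.integral_of_le hab.le, integral_Ioc_eq_integral_Ioo,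
    integral_Ioc_eq_integral_Ioo] at parts
  rw [parts, neg_neg]

theorem HasWeakDeriv.integral_smul_eq {f : L2 a b} (hf : HasWeakDeriv f 0)
    (hφ : IsTestFunction a b φ) (hψ : IsTestFunction a b ψ) (hψ1 : ∫ x, ψ x = 1) :
    ∫ x in Ioo a b, φ x • f x = (∫ x, φ x) • ∫ x in Ioo a b, ψ x • f x := by
  set I := ∫ x, φ x with hI
  have hzero : ∫ x, (φ x - I * ψ x) = 0 := by
    rw [integral_sub hφ.integrable_self (hψ.integrable_self.const_mul I), integral_const_mul, hψ1,
      ← hI, mul_one, sub_self]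
  obtain ⟨Φ, hΦ, hderiv⟩ := (hφ.sub_const_mul hψ I).exists_deriv_eq hzero
  have hweak : ∫ x in Ioo a b, (φ x • f x - I • ψ x • f x) = 0 := by
    have h := hf Φ hΦ
    rw [hderiv, ← map_zero (contLp a b), integral_smul_contLp] at h
    simpa [sub_smul, mul_smul, -Complex.real_smul] using h
  rwa [integral_sub (hφ.integrable f) ((hψ.integrable f).fun_smul I), integral_smul, sub_eq_zero]
    at hweak

theorem HasWeakDeriv.exists_eq_contLp_const (hab : a < b) {f : L2 a b} (hf : HasWeakDeriv f 0) :
    ∃ C : ℂ, f = contLp a b (ContinuousMap.const ℝ C) := by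
  obtain ⟨ψ, hψ, hψ1⟩ := exists_isTestFunction hab
  set C := ∫ x in Ioo a b, ψ x • f x with hC
  refine ⟨C, ?_⟩
  have hweak : HasWeakDeriv 0 (f + contLp a b (ContinuousMap.const ℝ (-C))) := by
    intro φ hφ
    rw [integral_smul_add (hφ.integrable _) (hφ.integrable _), hf.integral_smul_eq hφ hψ hψ1, ← hC,
      ← map_zero (contLp a b), integral_smul_contLp, integral_smul_contLp]
    simp only [ContinuousMap.coe_zero, Pi.zero_apply, smul_zero, integral_zero,
      ContinuousMap.const_apply, integral_neg, integral_smul_const, hφ.setIntegral_eq, smul_neg,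
      add_neg_cancel, neg_zero]
  rw [eq_neg_of_add_eq_zero_left hweak.eq_zero, ← map_neg]
  congr 1
  ext
  simp

theorem exists_hasDerivAt (V : C(ℝ, ℂ)) : ∃ u : C(ℝ, ℂ), ∀ x, HasDerivAt u (V x) x := by
  have h (x : ℝ) : HasDerivAt (fun x => ∫ y in 0..x, V y) (V x) x :=
    (V.continuous.integral_hasStrictDerivAt 0 x).hasDerivAt
  exact ⟨⟨_, continuous_iff_continuousAt.2 fun x => (h x).continuousAt⟩, h⟩

/-- The **du Bois-Reymond lemma**: subtracting a primitive of `V` reduces to a vanishing weak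
derivative. -/
theorem HasWeakDeriv.exists_eq_contLp (hab : a < b) {f : L2 a b} {V : C(ℝ, ℂ)}
    (hf : HasWeakDeriv f (contLp a b V)) :
    ∃ u : C(ℝ, ℂ), f = contLp a b u ∧ ∀ x, HasDerivAt u (V x) x := by
  obtain ⟨W, hW⟩ := exists_hasDerivAt V
  have hzero : HasWeakDeriv (f + (-1 : ℂ) • contLp a b W) 0 := by
    have h := hf.add ((hasWeakDeriv_contLp hW).smul (-1))
    rwa [neg_one_smul ℂ (contLp a b V), add_neg_cancel] at h
  obtain ⟨C, hC⟩ := hzero.exists_eq_contLp_const hab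
  refine ⟨ContinuousMap.const ℝ C + W, ?_, fun x => (hW x).const_add C⟩
  rw [map_add, ← hC, neg_one_smul, neg_add_cancel_right]

theorem VanishesAtEndpoints.exists_eq_contLp (hab : a < b) {f : L2 a b}
    (hf : VanishesAtEndpoints f) :
    ∃ u : C(ℝ, ℂ), f = contLp a b u ∧ u a = 0 ∧ u b = 0 := by
  obtain ⟨u, hu, hae, hua, hub⟩ := hf
  let w : C(ℝ, ℂ) := ⟨IccExtend hab.le ((Icc a b).domRestrict u),
    (continuousOn_iff_continuous_domRestrict.1 hu).Icc_extend'⟩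
  have hw : EqOn w u (Icc a b) := fun x hx => IccExtend_of_mem hab.le ((Icc a b).domRestrict u) hx
  refine ⟨w, Lp.ext ?_, (hw (left_mem_Icc.2 hab.le)).trans hua,
    (hw (right_mem_Icc.2 hab.le)).trans hub⟩
  filter_upwards [hae, coeFn_contLp a b w, ae_restrict_mem measurableSet_Ioo] with x hux hwx hx
  rw [← hux, hwx, hw (Ioo_subset_Icc_self hx)]

theorem exists_classical_solution (hab : a < b) {f : L2 a b} {μ : ℂ}
    (hf : (f, μ • f) ∈ dirichletGraph a b) :
    ∃ u v : C(ℝ, ℂ), f = contLp a b u ∧ (∀ x, HasDerivAt u (v x) x) ∧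
      (∀ x ∈ Icc a b, HasDerivAt v (-(2 * μ) * u x) x) ∧ u a = 0 ∧ u b = 0 := by
  obtain ⟨f₁, f₂, hff₁, hf₁f₂, hvanish, hμ⟩ := hf
  obtain ⟨U, hfU, hUa, hUb⟩ := VanishesAtEndpoints.exists_eq_contLp hab hvanish
  simp only at hff₁ hfU hμ
  have hf₂ : f₂ = contLp a b (-(2 * μ) • U) := by
    rw [map_smul, ← hfU, neg_smul, mul_smul, hμ, smul_smul, ← neg_smul]
    norm_num
  rw [hf₂] at hf₁f₂
  obtain ⟨v, rfl, hv⟩ := hf₁f₂.exists_eq_contLp hab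
  obtain ⟨u, hfu, hu⟩ := hff₁.exists_eq_contLp hab
  have huU : EqOn u U (Icc a b) := eqOn_Icc_of_contLp_eq hab (hfu.symm.trans hfU)
  refine ⟨u, v, hfu, hu, fun x hx => ?_, ?_, ?_⟩
  · rw [huU hx]
    exact hv x
  · rw [huU (left_mem_Icc.2 hab.le), hUa]
  · rw [huU (right_mem_Icc.2 hab.le), hUb]

end WeakDerivatives

/-! ### Dirichlet eigenfunctions -/

section Eigenfunctions

variable {a b : ℝ}

theorem eq_of_hasDerivAt_zero {w : ℝ → ℂ} (hw : ∀ x ∈ Icc a b, HasDerivAt w 0 x) {x : ℝ}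
    (hx : x ∈ Icc a b) : w x = w a :=
  constant_of_has_deriv_right_zero (fun x hx => (hw x hx).continuousAt.continuousWithinAt)
    (fun x hx => (hw x (Ico_subset_Icc_self hx)).hasDerivWithinAt) x hx

/-- The sine of wave number `κ` centred at `a`, a solution of `u'' = -κ² u` with `u(a) = 0`. -/
noncomputable def sine (κ : ℂ) (a : ℝ) : C(ℝ, ℂ) :=
  ⟨fun x => Complex.sin (κ * (x - a)), by fun_prop⟩

/-- The cosine of wave number `κ` centred at `a`, the derivative of `sine κ a` up to the factor
`κ`. -/
noncomputable def cosine (κ : ℂ) (a : ℝ) : C(ℝ, ℂ) :=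
  ⟨fun x => Complex.cos (κ * (x - a)), by fun_prop⟩

theorem sine_apply (κ : ℂ) (a x : ℝ) : sine κ a x = Complex.sin (κ * (x - a)) := rfl

theorem sine_left (κ : ℂ) (a : ℝ) : sine κ a a = 0 := by simp [sine_apply]

theorem hasDerivAt_ofReal_sub (a : ℝ) (x : ℝ) : HasDerivAt (fun x : ℝ => (x : ℂ) - a) 1 x :=
  ((hasDerivAt_id x).ofReal_comp).sub_const (a : ℂ)

theorem hasDerivAt_sine (κ : ℂ) (a x : ℝ) : HasDerivAt (sine κ a) (κ * cosine κ a x) x := by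
  have h := (Complex.hasDerivAt_sin _).comp x ((hasDerivAt_ofReal_sub a x).const_mul κ)
  rwa [mul_one, mul_comm] at h

theorem hasDerivAt_cosine (κ : ℂ) (a x : ℝ) : HasDerivAt (cosine κ a) (-κ * sine κ a x) x := by
  have h := (Complex.hasDerivAt_cos _).comp x ((hasDerivAt_ofReal_sub a x).const_mul κ)
  rwa [mul_one, neg_mul_comm, mul_comm] at h

section SineEquation

variable {κ : ℂ} {u v : ℝ → ℂ}

/-- Rotating `(κ u, v)` by the angle `κ (x - a)` yields two constants of motion. -/
theorem mul_eq_mul_sine (hu : ∀ x ∈ Icc a b, HasDerivAt u (v x) x)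
    (hv : ∀ x ∈ Icc a b, HasDerivAt v (-κ ^ 2 * u x) x) (hua : u a = 0) {x : ℝ}
    (hx : x ∈ Icc a b) : κ * u x = v a * sine κ a x := by
  have hfst : κ * u x * sine κ a x + v x * cosine κ a x = v a := by
    have h := eq_of_hasDerivAt_zero (w := fun x => κ * u x * sine κ a x + v x * cosine κ a x)
      (fun x hx => ((((hu x hx).const_mul κ).mul (hasDerivAt_sine κ a x)).add
        ((hv x hx).mul (hasDerivAt_cosine κ a x))).congr_deriv (by ring)) hx
    simpa [hua, sine, cosine] using h
  have hsnd : κ * u x * cosine κ a x - v x * sine κ a x = 0 := by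
    have h := eq_of_hasDerivAt_zero (w := fun x => κ * u x * cosine κ a x - v x * sine κ a x)
      (fun x hx => ((((hu x hx).const_mul κ).mul (hasDerivAt_cosine κ a x)).sub
        ((hv x hx).mul (hasDerivAt_sine κ a x))).congr_deriv (by ring)) hx
    simpa [hua, sine, cosine] using h
  have hsq : sine κ a x ^ 2 + cosine κ a x ^ 2 = 1 := Complex.sin_sq_add_cos_sq _
  linear_combination sine κ a x * hfst + cosine κ a x * hsnd - κ * u x * hsq

theorem eq_mul_sub_of_eq_zero (hu : ∀ x ∈ Icc a b, HasDerivAt u (v x) x)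
    (hv : ∀ x ∈ Icc a b, HasDerivAt v (-κ ^ 2 * u x) x) (hua : u a = 0) (hκ : κ = 0)
    {x : ℝ} (hx : x ∈ Icc a b) : u x = v a * (x - a) := by
  have hconst {y : ℝ} (hy : y ∈ Icc a b) : v y = v a :=
    eq_of_hasDerivAt_zero (fun x hx => (hv x hx).congr_deriv (by simp [hκ])) hy
  have h := eq_of_hasDerivAt_zero (w := fun x => u x - v a * (x - a))
    (fun x hx => ((hu x hx).sub ((hasDerivAt_ofReal_sub a x).const_mul (v a))).congr_deriv
      (by rw [hconst hx, mul_one, sub_self])) hx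
  simpa [hua, sub_eq_zero] using h

end SineEquation

/-- The wave number `kπ / (b - a)` of the `k`-th Dirichlet eigenfunction on `(a,b)`. -/
noncomputable def waveNumber (a b : ℝ) (k : ℕ) : ℝ := k * Real.pi / (b - a)

theorem exists_sq_eq_waveNumber_sq (hab : a < b) {κ : ℂ} {u v : ℝ → ℂ}
    (hu : ∀ x ∈ Icc a b, HasDerivAt u (v x) x)
    (hv : ∀ x ∈ Icc a b, HasDerivAt v (-κ ^ 2 * u x) x) (hua : u a = 0) (hub : u b = 0)
    (hne : ∃ x ∈ Icc a b, u x ≠ 0) : ∃ k : ℕ, 1 ≤ k ∧ κ ^ 2 = waveNumber a b k ^ 2 := by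
  obtain ⟨x, hx, hux⟩ := hne
  have hb : b ∈ Icc a b := right_mem_Icc.2 hab.le
  have hlen : (b : ℂ) - a ≠ 0 := sub_ne_zero.2 (by exact_mod_cast hab.ne')
  have hκ : κ ≠ 0 := by
    intro hκ
    have hva : v a = 0 := by
      simpa [hub, hlen] using (eq_mul_sub_of_eq_zero hu hv hua hκ hb).symm
    exact hux (by rw [eq_mul_sub_of_eq_zero hu hv hua hκ hx, hva, zero_mul])
  have hva : v a ≠ 0 := fun hva => by
    simpa [hva, hκ, hux] using mul_eq_mul_sine hu hv hua hx
  have hsin : Complex.sin (κ * (b - a)) = 0 := by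
    have h := mul_eq_mul_sine hu hv hua hb
    rw [hub, mul_zero] at h
    exact (mul_eq_zero.1 h.symm).resolve_left hva
  obtain ⟨n, hn⟩ := Complex.sin_eq_zero_iff.1 hsin
  have hκn : κ = n * Real.pi / (b - a) := by rw [eq_div_iff hlen, hn]
  refine ⟨n.natAbs, Int.natAbs_pos.2 fun hn0 => hκ (by simp [hκn, hn0]), ?_⟩
  have hsq : (n.natAbs : ℂ) ^ 2 = (n : ℂ) ^ 2 := by
    rw [← Int.cast_natCast, ← Int.cast_pow, Int.natAbs_sq, Int.cast_pow]
  rw [hκn, waveNumber]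
  push_cast
  rw [div_pow, div_pow, mul_pow, mul_pow, hsq]

/-- The `k`-th Dirichlet eigenvalue of `-Δ/2` on `(a,b)`. -/
noncomputable def dirichletEigenvalue (a b : ℝ) (k : ℕ) : ℝ := waveNumber a b k ^ 2 / 2

/-- The `k`-th Dirichlet eigenfunction of `-Δ/2` on `(a,b)`, not normalized. -/
noncomputable def sineLp (a b : ℝ) (k : ℕ) : L2 a b := contLp a b (sine (waveNumber a b k) a)

theorem waveNumber_mul (hab : a < b) (k : ℕ) : waveNumber a b k * (b - a) = k * Real.pi :=
  div_mul_cancel₀ _ (sub_pos.2 hab).ne'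

theorem waveNumber_nonneg (hab : a < b) (k : ℕ) : 0 ≤ waveNumber a b k :=
  div_nonneg (by positivity) (sub_pos.2 hab).le

theorem waveNumber_ne_zero (hab : a < b) {k : ℕ} (hk : 1 ≤ k) : waveNumber a b k ≠ 0 :=
  div_ne_zero (mul_ne_zero (by exact_mod_cast Nat.one_le_iff_ne_zero.1 hk) Real.pi_ne_zero)
    (sub_pos.2 hab).ne'

theorem dirichletEigenvalue_injective (hab : a < b) :
    Function.Injective (dirichletEigenvalue a b) := by
  intro k k' h
  have hwave : waveNumber a b k = waveNumber a b k' :=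
    (pow_left_inj₀ (waveNumber_nonneg hab k) (waveNumber_nonneg hab k') two_ne_zero).1
      ((div_left_inj' two_ne_zero).1 h)
  have hmul : (k : ℝ) * Real.pi = k' * Real.pi := by
    rw [← waveNumber_mul hab, ← waveNumber_mul hab, hwave]
  exact_mod_cast mul_right_cancel₀ Real.pi_ne_zero hmul

theorem sine_waveNumber_right (hab : a < b) (k : ℕ) : sine (waveNumber a b k) a b = 0 := by
  have h : (waveNumber a b k : ℂ) * (b - a) = (k * Real.pi : ℝ) := by
    rw [← waveNumber_mul hab]
    push_cast
    rfl
  simp [sine_apply, h, Complex.sin_nat_mul_pi]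

theorem hasDerivAt_mul_cosine_waveNumber (a b : ℝ) (k : ℕ) (x : ℝ) :
    HasDerivAt ((waveNumber a b k : ℂ) • cosine (waveNumber a b k) a)
      (-(2 * (dirichletEigenvalue a b k : ℂ)) * sine (waveNumber a b k) a x) x := by
  refine ((hasDerivAt_cosine _ a x).const_mul (waveNumber a b k : ℂ)).congr_deriv ?_
  rw [dirichletEigenvalue]
  push_cast
  ring

theorem contLp_mem_dirichletGraph {u v : C(ℝ, ℂ)} {μ : ℂ} (hu : ∀ x, HasDerivAt u (v x) x)
    (hv : ∀ x, HasDerivAt v (-(2 * μ) * u x) x) (hua : u a = 0) (hub : u b = 0) :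
    (contLp a b u, μ • contLp a b u) ∈ dirichletGraph a b := by
  refine ⟨contLp a b v, contLp a b (-(2 * μ) • u), hasWeakDeriv_contLp hu, hasWeakDeriv_contLp hv,
    ⟨u, u.continuous.continuousOn, (coeFn_contLp a b u).symm, hua, hub⟩, ?_⟩
  rw [map_smul, smul_smul]
  ring_nf

theorem sineLp_mem_dirichletGraph (hab : a < b) (k : ℕ) :
    (sineLp a b k, (dirichletEigenvalue a b k : ℂ) • sineLp a b k) ∈ dirichletGraph a b :=
  contLp_mem_dirichletGraph (hasDerivAt_sine _ a) (hasDerivAt_mul_cosine_waveNumber a b k)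
    (sine_left _ a) (sine_waveNumber_right hab k)

theorem eq_smul_sineLp (hab : a < b) {f : L2 a b} {μ : ℝ}
    (hf : (f, (μ : ℂ) • f) ∈ dirichletGraph a b) (hf0 : f ≠ 0) :
    ∃ k : ℕ, 1 ≤ k ∧ μ = dirichletEigenvalue a b k ∧ ∃ c : ℂ, f = c • sineLp a b k := by
  obtain ⟨u, v, rfl, hu, hv, hua, hub⟩ := exists_classical_solution hab hf
  have hne : ∃ x ∈ Icc a b, u x ≠ 0 := by
    by_contra! h
    exact hf0 ((contLp_congr (w := 0) h).trans (map_zero _))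
  obtain ⟨κ, hκ⟩ := IsAlgClosed.exists_pow_nat_eq (2 * (μ : ℂ)) two_pos
  obtain ⟨k, hk, hκk⟩ :=
    exists_sq_eq_waveNumber_sq hab (fun x _ => hu x) (hκ ▸ hv) hua hub hne
  rw [← hκ, hκk] at hv
  have hwave : (waveNumber a b k : ℂ) ≠ 0 := Complex.ofReal_ne_zero.2 (waveNumber_ne_zero hab hk)
  refine ⟨k, hk, ?_, v a / waveNumber a b k, ?_⟩
  · have hμ : 2 * μ = waveNumber a b k ^ 2 := by exact_mod_cast hκ.symm.trans hκk
    rw [dirichletEigenvalue, ← hμ, mul_div_cancel_left₀ μ two_ne_zero]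
  · rw [sineLp, ← map_smul]
    refine contLp_congr fun x hx => ?_
    rw [ContinuousMap.smul_apply, smul_eq_mul, div_mul_eq_mul_div, eq_div_iff hwave, mul_comm]
    exact mul_eq_mul_sine (fun x _ => hu x) hv hua hx

theorem sineLp_ne_zero (hab : a < b) {k : ℕ} (hk : 1 ≤ k) : sineLp a b k ≠ 0 := by
  intro h
  have hzero : EqOn (sine (waveNumber a b k) a) 0 (Icc a b) :=
    eqOn_Icc_of_contLp_eq hab (h.trans (map_zero _).symm)
  have hlen : 0 < b - a := sub_pos.2 hab
  have hk' : (1 : ℝ) ≤ k := by exact_mod_cast hk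
  have hquarter : a + (b - a) / (2 * k) ∈ Icc a b := by
    have hpos : 0 ≤ (b - a) / (2 * k) := by positivity
    have hle : (b - a) / (2 * k) ≤ b - a := div_le_self hlen.le (by linarith)
    constructor <;> linarith
  have hphase : waveNumber a b k * (a + (b - a) / (2 * k) - a) = Real.pi / 2 := by
    rw [waveNumber]
    field_simp
    ring
  have hone : sine (waveNumber a b k) a (a + (b - a) / (2 * k)) = 1 := by
    rw [sine_apply, ← Complex.ofReal_sub, ← Complex.ofReal_mul, hphase, ← Complex.ofReal_sin,
      Real.sin_pi_div_two, Complex.ofReal_one]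
  exact one_ne_zero (hone.symm.trans (hzero hquarter))

theorem conj_sine (q a x : ℝ) : starRingEnd ℂ (sine q a x) = sine q a x := by
  simp [sine_apply, ← Complex.sin_conj]

theorem integral_mul_eq_zero_of_hasDerivAt {u v w z : C(ℝ, ℂ)} {μ ν : ℂ}
    (hu : ∀ x, HasDerivAt u (v x) x) (hv : ∀ x, HasDerivAt v (-(2 * μ) * u x) x)
    (hw : ∀ x, HasDerivAt w (z x) x) (hz : ∀ x, HasDerivAt z (-(2 * ν) * w x) x)
    (hua : u a = 0) (hub : u b = 0) (hwa : w a = 0) (hwb : w b = 0) (hμν : μ ≠ ν) :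
    ∫ x in a..b, u x * w x = 0 := by
  have hwronskian (x : ℝ) :
      HasDerivAt (fun x => u x * z x - v x * w x) (2 * (μ - ν) * (u x * w x)) x :=
    (((hu x).mul (hz x)).sub ((hv x).mul (hw x))).congr_deriv (by ring)
  have h := intervalIntegral.integral_eq_sub_of_hasDerivAt (a := a) (b := b)
    (fun x _ => hwronskian x)
    (((u.continuous.mul w.continuous).const_mul _).intervalIntegrable _ _)
  rw [intervalIntegral.integral_const_mul, hua, hub, hwa, hwb] at h
  simpa [sub_ne_zero.2 hμν] using h

theorem inner_sineLp (hab : a < b) {k k' : ℕ} (h : k ≠ k') :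
    inner ℂ (sineLp a b k) (sineLp a b k') = 0 := by
  calc inner ℂ (sineLp a b k) (sineLp a b k')
    _ = ∫ x in Ioo a b, sine (waveNumber a b k) a x * sine (waveNumber a b k') a x := by
        rw [L2.inner_def]
        refine integral_congr_ae ?_
        filter_upwards [coeFn_contLp a b (sine (waveNumber a b k) a),
          coeFn_contLp a b (sine (waveNumber a b k') a)] with x hx hx'
        rw [sineLp, sineLp, hx, hx', RCLike.inner_apply, conj_sine, mul_comm]
    _ = ∫ x in a..b, sine (waveNumber a b k) a x * sine (waveNumber a b k') a x := by
        rw [intervalIntegral.integral_of_le hab.le, integral_Ioc_eq_integral_Ioo]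
    _ = 0 := integral_mul_eq_zero_of_hasDerivAt (hasDerivAt_sine _ a)
        (hasDerivAt_mul_cosine_waveNumber a b k) (hasDerivAt_sine _ a)
        (hasDerivAt_mul_cosine_waveNumber a b k') (sine_left _ a) (sine_waveNumber_right hab k)
        (sine_left _ a) (sine_waveNumber_right hab k')
        fun heq => h (dirichletEigenvalue_injective hab (Complex.ofReal_injective heq))

end Eigenfunctions

/-! ### Counting eigenvalues -/

section Counting

section LowEigenspan

variable {H : Type} [NormedAddCommGroup H] [InnerProductSpace ℂ H]

/-- The span of the eigenvectors of `T` for eigenvalues below `E`, whose dimension is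
`eigenvalueCount T E`. Eigenvectors are expressed through the graph of `T`, so that no membership
in the domain has to be carried along. -/
def lowEigenspan (T : H →ₗ.[ℂ] H) (E : ℝ) : Submodule ℂ H :=
  Submodule.span ℂ {f | ∃ μ : ℝ, μ < E ∧ (f, (μ : ℂ) • f) ∈ T.graph}

theorem mem_graph_iff_exists_apply_eq {T : H →ₗ.[ℂ] H} {f g : H} :
    (f, g) ∈ T.graph ↔ ∃ hf : f ∈ T.domain, T ⟨f, hf⟩ = g := by
  rw [LinearPMap.mem_graph_iff]
  exact ⟨fun ⟨⟨_, hf⟩, rfl, hfg⟩ => ⟨hf, hfg⟩, fun ⟨hf, hfg⟩ => ⟨⟨f, hf⟩, rfl, hfg⟩⟩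

theorem eigenvalueCount_eq_finrank (T : H →ₗ.[ℂ] H) (E : ℝ) :
    eigenvalueCount T E = Module.finrank ℂ (lowEigenspan T E) := by
  have hspan : lowEigenspan T E = Submodule.span ℂ
      {f | ∃ μ : ℝ, μ < E ∧ ∃ hf : f ∈ T.domain, T ⟨f, hf⟩ = (μ : ℂ) • f} := by
    simp only [lowEigenspan, mem_graph_iff_exists_apply_eq]
  rw [hspan, eigenvalueCount]

end LowEigenspan

section DirectSum

variable {ι : Type} [Fintype ι] {H : ι → Type} [∀ j, NormedAddCommGroup (H j)]
  [∀ j, InnerProductSpace ℂ (H j)] {T : ∀ j, H j →ₗ.[ℂ] H j} {E : ℝ}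

theorem mem_graph_directSumOp_iff {f g : PiLp 2 H} :
    (f, g) ∈ (directSumOp T).graph ↔ ∀ j, (f j, g j) ∈ (T j).graph := by
  simp only [mem_graph_iff_exists_apply_eq]
  refine ⟨fun ⟨hf, hfg⟩ j => ⟨hf j, congrArg (fun g : PiLp 2 H => g j) hfg⟩, fun h => ?_⟩
  choose hf hfg using h
  exact ⟨hf, PiLp.ext hfg⟩

theorem single_mem_graph_directSumOp [DecidableEq ι] {j : ι} {f g : H j}
    (h : (f, g) ∈ (T j).graph) :
    (PiLp.single 2 j f, PiLp.single 2 j g) ∈ (directSumOp T).graph := by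
  refine mem_graph_directSumOp_iff.2 fun i => ?_
  rcases eq_or_ne i j with rfl | hij
  · simpa using h
  · simp [hij]

theorem single_mem_lowEigenspan_directSumOp [DecidableEq ι] {j : ι} {f : H j}
    (hf : f ∈ lowEigenspan (T j) E) : PiLp.single 2 j f ∈ lowEigenspan (directSumOp T) E := by
  let single : H j →ₗ[ℂ] PiLp 2 H :=
    (WithLp.linearEquiv 2 ℂ (∀ j, H j)).symm.toLinearMap ∘ₗ LinearMap.single ℂ H j
  suffices h : lowEigenspan (T j) E ≤ (lowEigenspan (directSumOp T) E).comap single from h hf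
  refine Submodule.span_le.2 fun g ⟨μ, hμ, hg⟩ => Submodule.subset_span ⟨μ, hμ, ?_⟩
  rw [← map_smul]
  exact single_mem_graph_directSumOp hg

theorem mem_lowEigenspan_directSumOp_iff {f : PiLp 2 H} :
    f ∈ lowEigenspan (directSumOp T) E ↔ ∀ j, f j ∈ lowEigenspan (T j) E := by
  classical
  constructor
  · intro hf j
    suffices h : lowEigenspan (directSumOp T) E ≤
        (lowEigenspan (T j) E).comap (PiLp.projₗ 2 H j) from h hf
    exact Submodule.span_le.2 fun g ⟨μ, hμ, hg⟩ =>
      Submodule.subset_span ⟨μ, hμ, mem_graph_directSumOp_iff.1 hg j⟩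
  · intro hf
    have hsum : f = ∑ j, PiLp.single 2 j (f j) := by
      ext i
      simp [Finset.sum_apply]
    rw [hsum]
    exact Submodule.sum_mem _ fun j _ => single_mem_lowEigenspan_directSumOp (hf j)

theorem eigenvalueCount_directSumOp (T : ∀ j, H j →ₗ.[ℂ] H j) (E : ℝ)
    [∀ j, Module.Finite ℂ (lowEigenspan (T j) E)] :
    eigenvalueCount (directSumOp T) E = ∑ j, eigenvalueCount (T j) E := by
  let e : lowEigenspan (directSumOp T) E ≃ₗ[ℂ] ∀ j, lowEigenspan (T j) E :=
    { toFun := fun f j => ⟨f.1 j, mem_lowEigenspan_directSumOp_iff.1 f.2 j⟩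
      invFun := fun f =>
        ⟨WithLp.toLp 2 fun j => (f j : H j), mem_lowEigenspan_directSumOp_iff.2 fun j => (f j).2⟩
      map_add' := fun _ _ => rfl
      map_smul' := fun _ _ => rfl }
  simp only [eigenvalueCount_eq_finrank]
  rw [e.finrank_eq, Module.finrank_pi_fintype]

end DirectSum

section Interval

variable {a b E : ℝ}

theorem cLS_pos : 0 < cLS := div_pos Real.pi_pos (Real.sqrt_pos.2 two_pos)

theorem cLS_div_sqrt_pos (hE : 0 < E) : 0 < cLS / √E := div_pos cLS_pos (Real.sqrt_pos.2 hE)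

theorem dirichletEigenvalue_lt_iff (hab : a < b) (hE : 0 < E) (k : ℕ) :
    dirichletEigenvalue a b k < E ↔ k * (cLS / √E) < b - a := by
  have hlen : 0 < b - a := sub_pos.2 hab
  calc dirichletEigenvalue a b k < E
    _ ↔ waveNumber a b k ^ 2 < (√2 * √E) ^ 2 := by
        rw [dirichletEigenvalue, mul_pow, Real.sq_sqrt zero_le_two, Real.sq_sqrt hE.le,
          div_lt_iff₀' two_pos]
    _ ↔ waveNumber a b k < √2 * √E :=
        pow_lt_pow_iff_left₀ (waveNumber_nonneg hab k) (by positivity) two_ne_zero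
    _ ↔ k * (cLS / √E) < b - a := by
        rw [waveNumber, cLS, div_div, ← mul_div_assoc, div_lt_iff₀ hlen,
          div_lt_iff₀ (by positivity), mul_comm (b - a)]

theorem lt_of_fin_multiplesBelow (hE : 0 < E) (k : Fin (multiplesBelow (cLS / √E) (b - a))) :
    a < b := by
  have h : (k + 1 : ℕ) * (cLS / √E) < b - a :=
    (le_multiplesBelow_iff (cLS_div_sqrt_pos hE) (by omega)).1 (by omega)
  have hpos : 0 ≤ (k + 1 : ℕ) * (cLS / √E) := by
    have := cLS_div_sqrt_pos hE
    positivity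
  exact sub_pos.1 (hpos.trans_lt h)

theorem L2_eq_zero_of_le (hba : b ≤ a) (f : L2 a b) : f = 0 :=
  Lp.ext (by simp [Ioo_eq_empty_of_le hba, Filter.EventuallyEq])

theorem lowEigenspan_dirichletOp (a b : ℝ) (hE : 0 < E) :
    lowEigenspan (dirichletOp a b) E = Submodule.span ℂ
      (range fun k : Fin (multiplesBelow (cLS / √E) (b - a)) => sineLp a b (k + 1)) := by
  have hc : 0 < cLS / √E := cLS_div_sqrt_pos hE
  rw [lowEigenspan, dirichletOp_graph]
  refine le_antisymm (Submodule.span_le.2 ?_) (Submodule.span_mono ?_)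
  · rintro f ⟨μ, hμ, hf⟩
    rcases eq_or_ne f 0 with rfl | hf0
    · exact Submodule.zero_mem _
    have hab : a < b := by
      by_contra! hba
      exact hf0 (L2_eq_zero_of_le hba f)
    obtain ⟨k, hk, rfl, c, rfl⟩ := eq_smul_sineLp hab hf hf0
    have hkle := (le_multiplesBelow_iff hc hk).2 ((dirichletEigenvalue_lt_iff hab hE k).1 hμ)
    refine Submodule.smul_mem _ c (Submodule.subset_span ⟨⟨k - 1, by omega⟩, ?_⟩)
    dsimp only
    rw [Nat.sub_add_cancel hk]
  · rintro _ ⟨k, rfl⟩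
    have hab := lt_of_fin_multiplesBelow hE k
    refine ⟨_, (dirichletEigenvalue_lt_iff hab hE (k + 1)).2 ?_,
      sineLp_mem_dirichletGraph hab (k + 1)⟩
    exact (le_multiplesBelow_iff hc (by omega)).1 (by omega)

theorem eigenvalueCount_dirichletOp (a b : ℝ) (hE : 0 < E) :
    eigenvalueCount (dirichletOp a b) E = multiplesBelow (cLS / √E) (b - a) := by
  have hind : LinearIndependent ℂ
      fun k : Fin (multiplesBelow (cLS / √E) (b - a)) => sineLp a b (k + 1) := by
    refine linearIndependent_of_ne_zero_of_inner_eq_zero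
      (fun k => sineLp_ne_zero (lt_of_fin_multiplesBelow hE k) (by omega)) fun k k' hkk' => ?_
    exact inner_sineLp (lt_of_fin_multiplesBelow hE k) fun h => hkk' (Fin.ext (by omega))
  rw [eigenvalueCount_eq_finrank, lowEigenspan_dirichletOp a b hE, finrank_span_eq_card hind,
    Fintype.card_fin]

end Interval

theorem eigenvalueCount_hamiltonian (L : ℝ) {m : ℕ} (y : Fin m → ℝ) {E : ℝ} (hE : 0 < E) :
    eigenvalueCount (hamiltonian L y) E = ∑ j, multiplesBelow (cLS / √E) (spacing L y j) := by
  have hfin (j : Fin (m + 1)) : Module.Finite ℂ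
      (lowEigenspan (dirichletOp (nodes L y j.castSucc) (nodes L y j.succ)) E) := by
    rw [lowEigenspan_dirichletOp _ _ hE]
    exact Module.Finite.span_of_finite ℂ (finite_range _)
  rw [hamiltonian, eigenvalueCount_directSumOp]
  exact Finset.sum_congr rfl fun j _ => eigenvalueCount_dirichletOp _ _ hE

end Counting

/-! ### Thermodynamic limit and Lifshitz tail -/

section ThermodynamicLimit

variable {lam : ℝ}

theorem IsTypical.tendsto_finiteIDS {u : ∀ m : ℕ, Fin m → ℝ} (hu : IsTypical u) {α : Type*}
    {l : Filter α} {m : α → ℕ} {L : α → ℝ} (hL : Tendsto L l atTop) (hlam : 0 < lam)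
    (hmL : Tendsto (fun x => ((m x : ℝ) + 1) / L x) l (𝓝 lam)) {E : ℝ} (hE : 0 < E) :
    Tendsto (fun x => finiteIDS (L x) (fun k => L x * u (m x) k) E) l (𝓝 (limitIDS lam E)) := by
  have h := hu.tendsto_sum_multiplesBelow_spacing hlam hL hmL (cLS_div_sqrt_pos hE)
  have hexponent : lam * (cLS / √E) = cLS * lam / √E := by ring
  rw [hexponent] at h
  refine h.congr fun x => ?_
  rw [finiteIDS, eigenvalueCount_hamiltonian _ _ hE, Nat.cast_sum]

variable {Ω : Type*} [MeasurableSpace Ω] {P : Measure Ω}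

theorem inv_mul_mem_box_one_iff {L : ℝ} (hL : 0 < L) {x : ℝ} : L⁻¹ * x ∈ box 1 ↔ x ∈ box L := by
  simp only [box, mem_Icc, ← div_eq_inv_mul, le_div_iff₀ hL, div_le_iff₀ hL]
  constructor <;> rintro ⟨hleft, hright⟩ <;> constructor <;> linarith

theorem volume_box (L : ℝ) : volume (box L) = ENNReal.ofReal L := by
  rw [box, Real.volume_Icc, sub_neg_eq_add, add_halves]

theorem map_inv_mul_cond_box {L : ℝ} (hL : 0 < L) :
    (volume[|box L]).map (fun x => L⁻¹ * x) = volume[|box 1] := by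
  ext s hs
  have hbox (L : ℝ) : MeasurableSet (box L) := measurableSet_Icc
  have hpre : box L ∩ (fun x => L⁻¹ * x) ⁻¹' s = (fun x => L⁻¹ * x) ⁻¹' (box 1 ∩ s) := by
    ext x
    simp only [mem_inter_iff, mem_preimage, inv_mul_mem_box_one_iff hL]
  rw [Measure.map_apply (measurable_const_mul _) hs, cond_apply (hbox L),
    cond_apply (hbox 1), hpre, Real.volume_preimage_mul_left (inv_ne_zero hL.ne'), inv_inv,
    abs_of_pos hL, volume_box, volume_box, ENNReal.ofReal_one, inv_one, ← mul_assoc,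
    ENNReal.inv_mul_cancel (by simpa using hL) ENNReal.ofReal_ne_top]

theorem IsUniformImpurities.rescale {L : ℝ} (hL : 0 < L) {m : ℕ} {Y : Fin m → Ω → ℝ}
    (hY : IsUniformImpurities P L Y) : IsUniformImpurities P 1 fun k ω => L⁻¹ * Y k ω where
  measurable k := (hY.measurable k).const_mul _
  indep := hY.indep.comp (fun _ x => L⁻¹ * x) fun _ => measurable_const_mul _
  uniform k := by
    have huniform : P.map (Y k) = volume[|box L] := hY.uniform k
    rw [pdf.IsUniform, ← map_inv_mul_cond_box hL, ← huniform,
      Measure.map_map (measurable_const_mul _) (hY.measurable k)]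
    rfl

theorem tendsto_atTop_of_tendsto_div {L : ℕ → ℝ} (hlam : 0 < lam)
    (hmL : Tendsto (fun m : ℕ => ((m : ℝ) + 1) / L m) atTop (𝓝 lam)) : Tendsto L atTop atTop := by
  have hnum : Tendsto (fun m : ℕ => (m : ℝ) + 1) atTop atTop :=
    tendsto_atTop_add_const_right _ _ tendsto_natCast_atTop_atTop
  refine ((hmL.inv₀ hlam.ne').pos_mul_atTop (inv_pos.2 hlam) hnum).congr fun m => ?_
  rw [inv_div, div_mul_cancel₀ _ (Nat.cast_add_one_ne_zero m)]

variable [IsProbabilityMeasure P]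

theorem ae_tendsto_finiteIDS_nat (hlam : 0 < lam) {L : ℕ → ℝ} (hL : ∀ m, 0 < L m)
    (hmL : Tendsto (fun m : ℕ => ((m : ℝ) + 1) / L m) atTop (𝓝 lam)) {Y : ∀ m : ℕ, Fin m → Ω → ℝ}
    (hY : ∀ m, IsUniformImpurities P (L m) (Y m)) :
    ∀ᵐ ω ∂P, ∀ E : ℝ, 0 < E →
      Tendsto (fun m : ℕ => finiteIDS (L m) (fun k => Y m k ω) E) atTop
        (𝓝 (limitIDS lam E)) := by
  filter_upwards [ae_isTypical fun m => (hY m).rescale (hL m)] with ω hω E hE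
  simpa only [mul_inv_cancel_left₀ (hL _).ne'] using
    hω.tendsto_finiteIDS (tendsto_atTop_of_tendsto_div hlam hmL) hlam hmL hE

theorem ae_tendsto_finiteIDS_real (hlam : 0 < lam) {m : ℝ → ℕ}
    (hmL : Tendsto (fun L : ℝ => ((m L : ℝ) + 1) / L) atTop (𝓝 lam)) {U : ∀ m : ℕ, Fin m → Ω → ℝ}
    (hU : ∀ m, IsUniformImpurities P 1 (U m)) :
    ∀ᵐ ω ∂P, ∀ E : ℝ, 0 < E →
      Tendsto (fun L : ℝ => finiteIDS L (fun k => L * U (m L) k ω) E) atTop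
        (𝓝 (limitIDS lam E)) := by
  filter_upwards [ae_isTypical hU] with ω hω E hE
  exact hω.tendsto_finiteIDS tendsto_id hlam hmL hE

end ThermodynamicLimit

section LifshitzTail

variable {lam : ℝ}

theorem tendsto_cLS_mul_div_sqrt (hlam : 0 < lam) :
    Tendsto (fun E : ℝ => cLS * lam / √E) (𝓝[>] 0) atTop := by
  have hsqrt : Tendsto (fun E : ℝ => √E) (𝓝[>] 0) (𝓝[>] 0) := by
    refine tendsto_nhdsWithin_iff.2 ⟨?_, ?_⟩
    · simpa using (Real.continuous_sqrt.tendsto 0).mono_left nhdsWithin_le_nhds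
    · filter_upwards [self_mem_nhdsWithin] with E hE
      exact Real.sqrt_pos.2 hE
  exact (tendsto_inv_nhdsGT_zero.comp hsqrt).const_mul_atTop (mul_pos cLS_pos hlam)

theorem tendsto_exp_neg_cLS_mul_div_sqrt (hlam : 0 < lam) :
    Tendsto (fun E : ℝ => Real.exp (-(cLS * lam / √E))) (𝓝[>] 0) (𝓝 0) :=
  Real.tendsto_exp_neg_atTop_nhds_zero.comp (tendsto_cLS_mul_div_sqrt hlam)

theorem isBigO_div_one_sub_self : (fun x : ℝ => x / (1 - x)) =O[𝓝 0] fun x => x := by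
  have hlim : Tendsto (fun x : ℝ => (1 - x)⁻¹) (𝓝 0) (𝓝 (1 - 0)⁻¹) :=
    (tendsto_id.const_sub 1).inv₀ (by norm_num)
  simpa [div_eq_mul_inv] using (isBigO_refl (fun x : ℝ => x) (𝓝 0)).mul (hlim.isBigO_one ℝ)

theorem limitIDS_div_sub_one_isBigO (hlam : 0 < lam) :
    (fun E : ℝ => limitIDS lam E / (lam * Real.exp (-(cLS * lam / √E))) - 1) =O[𝓝[>] 0]
      fun E : ℝ => Real.exp (-(cLS * lam / √E)) := by
  have hx := tendsto_exp_neg_cLS_mul_div_sqrt hlam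
  refine (isBigO_div_one_sub_self.comp_tendsto hx).congr' ?_ EventuallyEq.rfl
  filter_upwards [hx.eventually_lt_const one_pos] with E hE
  have hsub : 1 - Real.exp (-(cLS * lam / √E)) ≠ 0 := (sub_pos.2 hE).ne'
  rw [limitIDS, Function.comp_apply]
  field_simp
  ring

theorem log_limitIDS_isEquivalent (hlam : 0 < lam) :
    (fun E : ℝ => Real.log (limitIDS lam E)) ~[𝓝[>] 0] fun E : ℝ => -(cLS * lam / √E) := by
  have hx := tendsto_exp_neg_cLS_mul_div_sqrt hlam
  have hlim : Tendsto (fun E : ℝ => Real.log lam - Real.log (1 - Real.exp (-(cLS * lam / √E))))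
      (𝓝[>] 0) (𝓝 (Real.log lam - Real.log (1 - 0))) :=
    ((hx.const_sub 1).log (by norm_num)).const_sub _
  have hone : (fun _ : ℝ => (1 : ℝ)) =o[𝓝[>] 0] fun E : ℝ => -(cLS * lam / √E) := by
    rw [isLittleO_one_left_iff]
    simp only [norm_neg]
    exact tendsto_norm_atTop_atTop.comp (tendsto_cLS_mul_div_sqrt hlam)
  refine ((hlim.isBigO_one ℝ).trans_isLittleO hone).congr' ?_ EventuallyEq.rfl
  filter_upwards [hx.eventually_lt_const one_pos] with E hE
  rw [Pi.sub_apply, limitIDS, Real.log_mul hlam.ne' (div_pos (Real.exp_pos _) (sub_pos.2 hE)).ne',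
    Real.log_div (Real.exp_pos _).ne' (sub_pos.2 hE).ne', Real.log_exp]
  ring

end LifshitzTail

end LuttingerSy

/-- Let `lam > 0`. With `n = m + 1` intervals, i.e. `m` impurities, the thermodynamic limit is
`n → ∞`, `L → ∞`, `n / L → lam`.

(1) Volumes `L m` along the number of impurities: the `m` impurities in `[-L m / 2, L m / 2]` are
independent and uniform for each `m`, with no assumption on the joint law for different `m`.

(2) Continuous volume `L → ∞` with an arbitrary number `m L` of impurities: those in
`[-L/2, L/2]` are `L` times independent uniform points of `[-1/2, 1/2]`, which depend on `L` only
through their number (again with no assumption on the joint law for different numbers).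

In both cases the finite-volume integrated density of states converges almost surely, for all
energies simultaneously, to the nonrandom function `limitIDS lam`. (3), (4): Lifshitz tail. -/
theorem mainTheorem3 {Ω : Type*} [MeasurableSpace Ω] (P : Measure Ω) [IsProbabilityMeasure P]
    (lam : ℝ) (hlam : 0 < lam) :
    (∀ (L : ℕ → ℝ) (_ : ∀ m, 0 < L m)
      (_ : Tendsto (fun m : ℕ => ((m : ℝ) + 1) / L m) atTop (𝓝 lam))
      (Y : ∀ m : ℕ, Fin m → Ω → ℝ)
      (_ : ∀ m, LuttingerSy.IsUniformImpurities P (L m) (Y m)),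
      ∀ᵐ ω ∂P, ∀ E : ℝ, 0 < E →
        Tendsto (fun m : ℕ => LuttingerSy.finiteIDS (L m) (fun k => Y m k ω) E) atTop
          (𝓝 (LuttingerSy.limitIDS lam E))) ∧
    (∀ (m : ℝ → ℕ)
      (_ : Tendsto (fun L : ℝ => ((m L : ℝ) + 1) / L) atTop (𝓝 lam))
      (U : ∀ m : ℕ, Fin m → Ω → ℝ)
      (_ : ∀ m, LuttingerSy.IsUniformImpurities P 1 (U m)),
      ∀ᵐ ω ∂P, ∀ E : ℝ, 0 < E →
        Tendsto (fun L : ℝ => LuttingerSy.finiteIDS L (fun k => L * U (m L) k ω) E) atTop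
          (𝓝 (LuttingerSy.limitIDS lam E))) ∧
    (fun E : ℝ => LuttingerSy.limitIDS lam E /
        (lam * Real.exp (-(LuttingerSy.cLS * lam / √E))) - 1) =O[𝓝[>] 0]
      (fun E : ℝ => Real.exp (-(LuttingerSy.cLS * lam / √E))) ∧
    (fun E : ℝ => Real.log (LuttingerSy.limitIDS lam E)) ~[𝓝[>] 0]
      (fun E : ℝ => -(LuttingerSy.cLS * lam / √E)) :=
  ⟨fun _ hL hmL _ hY => LuttingerSy.ae_tendsto_finiteIDS_nat hlam hL hmL hY,
    fun _ hmL _ hU => LuttingerSy.ae_tendsto_finiteIDS_real hlam hmL hU,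
    LuttingerSy.limitIDS_div_sub_one_isBigO hlam, LuttingerSy.log_limitIDS_isEquivalent hlam⟩
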